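/- Let $\mathbb{T}\subseteq\mathbb{R}$ be a time scale (a nonempty closed set) that is unbounded above and has bounded graininess, where $\sigma(t)=\inf\{s\in\mathbb{T}: s>t\}$ and $\mu(t)=\sigma(t)-t$. Let $A\in\mathbb{R}^{n\times n}$, $B\in\mathbb{R}^{n\times m}$, $C\in\mathbb{R}^{p\times n}$ be constant matrices such that the system $$x^{\Delta}(t)=Ax(t)+Bu(t),\qquad y(t)=Cx(t)$$ is regressive, i.e. $I+\mu(t)A$ is invertible for every $t\in\mathbb{T}$, and let $G(z)$ be a $p\times m$ matrix of real rational functions. A regressive system with constant coefficients $(A,B,C)$ is a realization of $G(z)$ of dimension $n$ if $C(zI-A)^{-1}B=G(z)$ (as matrices of rational functions); it is minimal if $G(z)$ has no such realization of dimension less than $n$. For $t_0<t_f$ in $\mathbb{T}$, the system is controllable on $[t_0,t_f]$ if for all $x_0,x_f\in\mathbb{R}^n$ there is an rd-continuous input $u$ for which the solution on $\{t\in\mathbb{T}: t\ge t_0\}$ with $x(t_0)=x_0$ satisfies $x(t_f)=x_f$; it is observable on $[t_0,t_f]$ if the initial state $x(t_0)$ of a solution with $u=0$ is uniquely determined by the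 response $y(t)$, $t\in\mathbb{T}$, $t_0\le t<t_f$. It is called controllable (observable) if it is controllable (observable) on some interval $[t_0,t_f]$ with $t_0<t_f$ in $\mathbb{T}$. Suppose that the system is a realization of $G(z)$. Then it is a minimal realization of $G(z)$ if and only if it is both controllable and observable. Moreover, if it is minimal, then for every $t_0\in\mathbb{T}$ there is $t_f\in\mathbb{T}$ with $t_f>t_0$ such that it is both controllable and observable on $[t_0,t_f]$. -/

import Mathlib

open scoped Topology

namespace TimeScale

/-- A time scale: a nonempty closed set of real numbers. -/
def IsTimeScale (T : Set ℝ) : Prop :=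
  T.Nonempty ∧ IsClosed T

/-- Forward jump operator `σ(t) = inf {s ∈ T : t < s}`. It is used only for time scales that are
unbounded above, so that the set is nonempty. -/
noncomputable def sigma (T : Set ℝ) (t : ℝ) : ℝ :=
  sInf {s | s ∈ T ∧ t < s}

/-- Graininess `μ(t) = σ(t) - t`. -/
noncomputable def graininess (T : Set ℝ) (t : ℝ) : ℝ :=
  sigma T t - t

/-- The graininess of `T` is bounded. -/
def HasBoundedGraininess (T : Set ℝ) : Prop :=
  ∃ M : ℝ, ∀ t ∈ T, graininess T t ≤ M

/-- `f` has delta derivative `f'` at `t` on the time scale `T`: for every `ε > 0`,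
`‖f (σ t) - f s - (σ t - s) f'‖ ≤ ε |σ t - s|` for all `s ∈ T` in a neighbourhood of `t`. -/
def HasDeltaDerivAt {E : Type*} [NormedAddCommGroup E] [NormedSpace ℝ E]
    (T : Set ℝ) (f : ℝ → E) (f' : E) (t : ℝ) : Prop :=
  ∀ ε : ℝ, 0 < ε → ∀ᶠ s in 𝓝[T] t,
    ‖f (sigma T t) - f s - (sigma T t - s) • f'‖ ≤ ε * |sigma T t - s|

/-- `f` is rd-continuous on `T`: it is continuous (along `T`) at every right-dense point of `T`
and has a finite left limit (along `T`) at every left-dense point of `T`. At points that are not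
left-dense the filter below is `⊥`, and the second requirement is void. -/
def RdContinuous {E : Type*} [TopologicalSpace E] (T : Set ℝ) (f : ℝ → E) : Prop :=
  ∀ t ∈ T,
    (sigma T t = t → ContinuousWithinAt f T t) ∧
    ∃ l : E, Filter.Tendsto f (𝓝[T ∩ Set.Iio t] t) (𝓝 l)

/-- The constant coefficients of the system `x^Δ = A x + B u`, `y = C x`
with `n` states, `m` inputs and `p` outputs. -/
structure LTISystem (n m p : ℕ) where
  A : Matrix (Fin n) (Fin n) ℝ
  B : Matrix (Fin n) (Fin m) ℝ
  C : Matrix (Fin p) (Fin n) ℝ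

namespace LTISystem

variable {n m p : ℕ}

/-- `I + μ(t) A` is invertible for all `t ∈ T`. -/
def Regressive (T : Set ℝ) (S : LTISystem n m p) : Prop :=
  ∀ t ∈ T, IsUnit (1 + graininess T t • S.A)

/-- `x` solves `x^Δ(t) = A x(t) + B u(t)` for all `t ∈ T` with `t ≥ t₀`. -/
def IsSolution (T : Set ℝ) (S : LTISystem n m p) (t₀ : ℝ)
    (u : ℝ → Fin m → ℝ) (x : ℝ → Fin n → ℝ) : Prop :=
  ∀ t ∈ T, t₀ ≤ t →
    HasDeltaDerivAt (T ∩ Set.Ici t₀) x (S.A.mulVec (x t) + S.B.mulVec (u t)) t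

/-- Every initial state `x₀` at time `t₀` can be driven to every final state `x_f` at time `t_f`
by some rd-continuous input. -/
def ControllableOn (T : Set ℝ) (S : LTISystem n m p) (t₀ t_f : ℝ) : Prop :=
  ∀ x₀ x_f : Fin n → ℝ, ∃ u : ℝ → Fin m → ℝ, RdContinuous T u ∧
    ∃ x : ℝ → Fin n → ℝ, S.IsSolution T t₀ u x ∧ x t₀ = x₀ ∧ x t_f = x_f

/-- The initial state at time `t₀` is uniquely determined by the zero-input response
`y(t) = C x(t)`, `t ∈ T`, `t₀ ≤ t < t_f`. -/
def ObservableOn (T : Set ℝ) (S : LTISystem n m p) (t₀ t_f : ℝ) : Prop :=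
  ∀ x x' : ℝ → Fin n → ℝ,
    S.IsSolution T t₀ (fun _ => 0) x → S.IsSolution T t₀ (fun _ => 0) x' →
    (∀ t ∈ T, t₀ ≤ t → t < t_f → S.C.mulVec (x t) = S.C.mulVec (x' t)) →
    x t₀ = x' t₀

/-- Controllable on some interval `[t₀, t_f]` with `t₀ < t_f` in `T`. -/
def Controllable (T : Set ℝ) (S : LTISystem n m p) : Prop :=
  ∃ t₀ ∈ T, ∃ t_f ∈ T, t₀ < t_f ∧ S.ControllableOn T t₀ t_f

/-- Observable on some interval `[t₀, t_f]` with `t₀ < t_f` in `T`. -/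
def Observable (T : Set ℝ) (S : LTISystem n m p) : Prop :=
  ∃ t₀ ∈ T, ∃ t_f ∈ T, t₀ < t_f ∧ S.ObservableOn T t₀ t_f

/-- The matrix `C (zI - A)⁻¹ B` of rational functions of `z`. -/
noncomputable def transferFunction (S : LTISystem n m p) : Matrix (Fin p) (Fin m) (RatFunc ℝ) :=
  S.C.map RatFunc.C *
    ((RatFunc.X : RatFunc ℝ) • (1 : Matrix (Fin n) (Fin n) (RatFunc ℝ)) - S.A.map RatFunc.C)⁻¹ *
    S.B.map RatFunc.C

/-- The system is regressive on `T`, and `C (zI - A)⁻¹ B = G(z)`. -/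
def IsRealization (T : Set ℝ) (S : LTISystem n m p)
    (G : Matrix (Fin p) (Fin m) (RatFunc ℝ)) : Prop :=
  S.Regressive T ∧ S.transferFunction = G

/-- A realization of `G` such that `G` has no realization of smaller dimension. -/
def IsMinimalRealization (T : Set ℝ) (S : LTISystem n m p)
    (G : Matrix (Fin p) (Fin m) (RatFunc ℝ)) : Prop :=
  S.IsRealization T G ∧
    ∀ k : ℕ, k < n → ∀ S' : LTISystem k m p, ¬ S'.IsRealization T G

end LTISystem

end TimeScale

/-! Both analytic properties are equivalent, on long enough intervals, to Kalman's conditions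
`KalmanControllable` and `KalmanObservable`, which involve only the matrices.

Algebra. If some w ≠ 0 kills every A^j B, the states annihilated by all w A^j form a proper
A-invariant subspace containing the range of B. Restricting to it keeps the transfer function and
regressivity but lowers the dimension (`exists_smaller_of_not_kalmanControllable`); transposition
handles observability. Conversely, the transfer function determines the Markov parameters C A^j B
(`markov_eq`), and under both conditions the state space embeds into the space of sequences C' A'^i
x' of any other realization (`dim_le_of_kalman`).

Analysis. Solutions are series ∑ h_k(t, t₀) c_k in the generalized monomials, where |h_k| ≤ |t -
t₀|^k / k!. A vector killed by every C A^j starts a solution with zero output, and by Gronwall a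
solution starting at 0 never leaves an invariant subspace containing the range of B. So
controllability and observability on any interval imply Kalman's conditions. Conversely, a zero
output has zero delta derivatives as long as the interval leaves room for the jumps. For
controllability, the input h_k(·, t₀) v steers 0 to ∑_j h_{k+1+j}(t_f) A^j B v. If w is orthogonal
to all these states, the factorial decay of h lets one term dominate at a time, so w A^j B v = 0 for
j < n once h_n(t_f) > 0 (`eq_zero_of_forall_tsum_shift_eq_zero`). Cayley–Hamilton covers the
remaining j. -/

namespace TimeScale

open Set Filter

/-! ### Forward jumps and induction on time scales -/

section Basic

variable {T : Set ℝ} {t s : ℝ}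

theorem nonempty_gt (hu : ¬ BddAbove T) (t : ℝ) : {s | s ∈ T ∧ t < s}.Nonempty := by
  obtain ⟨s, hs, hts⟩ := not_bddAbove_iff.1 hu t
  exact ⟨s, hs, hts⟩

theorem bddBelow_gt (t : ℝ) : BddBelow {s | s ∈ T ∧ t < s} := ⟨t, fun _ h => h.2.le⟩

theorem le_sigma (hu : ¬ BddAbove T) (t : ℝ) : t ≤ sigma T t :=
  le_csInf (nonempty_gt hu t) fun _ h => h.2.le

theorem sigma_le (hs : s ∈ T) (h : t < s) : sigma T t ≤ s :=
  csInf_le (bddBelow_gt t) ⟨hs, h⟩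

theorem sigma_mem (hc : IsClosed T) (hu : ¬ BddAbove T) (t : ℝ) : sigma T t ∈ T :=
  closure_minimal (fun _ h => h.1) hc (csInf_mem_closure (nonempty_gt hu t) (bddBelow_gt t))

theorem exists_mem_Ioo_of_sigma_eq (hu : ¬ BddAbove T) (h : sigma T t = t) {r : ℝ} (hr : t < r) :
    ∃ s ∈ T, t < s ∧ s < r := by
  obtain ⟨s, hs, hsr⟩ := exists_lt_of_csInf_lt (nonempty_gt hu t) (h.trans_lt hr)
  exact ⟨s, hs.1, hs.2, hsr⟩

theorem sigma_inter_Ici {t₀ : ℝ} (h : t₀ ≤ t) : sigma (T ∩ Ici t₀) t = sigma T t := by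
  unfold sigma
  congr 1
  ext s
  exact ⟨fun hs => ⟨hs.1.1, hs.2⟩, fun hs => ⟨⟨hs.1, h.trans hs.2.le⟩, hs.2⟩⟩

theorem not_bddAbove_inter_Ici (hu : ¬ BddAbove T) (t₀ : ℝ) : ¬ BddAbove (T ∩ Ici t₀) := by
  rw [not_bddAbove_iff] at hu ⊢
  intro x
  obtain ⟨y, hy, hxy⟩ := hu (max x t₀)
  exact ⟨y, ⟨hy, (le_max_right x t₀).trans hxy.le⟩, (le_max_left x t₀).trans_lt hxy⟩

/-- The induction principle on time scales. -/
theorem timeScale_induction {t₀ : ℝ} (hc : IsClosed T) (hu : ¬ BddAbove T) (ht₀ : IsLeast T t₀)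
    {P : ℝ → Prop} (h0 : P t₀) (hσ : ∀ t ∈ T, P t → P (sigma T t))
    (hd : ∀ t ∈ T, sigma T t = t → P t → ∃ r > t, ∀ s ∈ T, t < s → s < r → P s)
    (hl : ∀ t ∈ T, (∀ r < t, ∃ s ∈ T, r < s ∧ s < t) → (∀ s ∈ T, s < t → P s) → P t) :
    ∀ t ∈ T, P t := by
  by_contra! hbad
  obtain ⟨b, hbT, hbP⟩ := hbad
  set Z := {t | t ∈ T ∧ ¬ P t} with hZ
  have hne : Z.Nonempty := ⟨b, hbT, hbP⟩
  have hbb : BddBelow Z := ⟨t₀, fun t ht => ht₀.2 ht.1⟩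
  set τ := sInf Z with hτ
  have hτT : τ ∈ T := closure_minimal (fun _ h => h.1) hc (csInf_mem_closure hne hbb)
  have hlt : ∀ s ∈ T, s < τ → P s := fun s hs hsτ => by
    by_contra hP
    exact absurd (csInf_le hbb ⟨hs, hP⟩) (not_le.2 hsτ)
  have hPτ : P τ := by
    by_cases hld : ∀ r < τ, ∃ s ∈ T, r < s ∧ s < τ
    · exact hl τ hτT hld hlt
    push Not at hld
    obtain ⟨r, hr, hrs⟩ := hld
    rcases (ht₀.2 hτT).eq_or_lt with h | h
    · rwa [← h]
    have hne' : (T ∩ Iic r).Nonempty :=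
      ⟨t₀, ht₀.1, by by_contra hh; exact absurd (hrs t₀ ht₀.1 (not_le.1 hh)) (not_le.2 h)⟩
    have hba : BddAbove (T ∩ Iic r) := ⟨r, fun _ h => h.2⟩
    -- No point of T lies strictly between r and τ, so τ is left-scattered: it is the jump of the
    -- greatest point of T up to r.
    have hρ : sSup (T ∩ Iic r) ∈ T ∩ Iic r := (hc.inter isClosed_Iic).csSup_mem hne' hba
    have hστ : sigma T (sSup (T ∩ Iic r)) = τ := by
      refine le_antisymm (sigma_le hτT (hρ.2.trans_lt hr)) (le_csInf (nonempty_gt hu _) ?_)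
      rintro s ⟨hs, hs'⟩
      refine hrs s hs (lt_of_not_ge fun hsr => ?_)
      exact absurd (le_csSup hba ⟨hs, hsr⟩) (not_le.2 hs')
    rw [← hστ]
    exact hσ _ hρ.1 (hlt _ hρ.1 (hρ.2.trans_lt hr))
  -- Since P holds at τ = inf Z, points of Z would have to accumulate at τ from the right; both
  -- kinds of τ exclude this.
  rcases (le_sigma hu τ).eq_or_lt with h | h
  · obtain ⟨r, hr, hrP⟩ := hd τ hτT h.symm hPτ
    obtain ⟨z, hz, hzr⟩ := exists_lt_of_csInf_lt hne hr
    rcases (csInf_le hbb hz).eq_or_lt with h' | h'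
    · exact hz.2 (h' ▸ hPτ)
    · exact hz.2 (hrP z hz.1 h' hzr)
  · obtain ⟨z, hz, hzr⟩ := exists_lt_of_csInf_lt hne h
    rcases (csInf_le hbb hz).eq_or_lt with h' | h'
    · exact hz.2 (h' ▸ hPτ)
    · exact absurd (sigma_le hz.1 h') (not_le.2 hzr)

end Basic

/-! ### Delta derivatives and Gronwall uniqueness -/

section DeltaDeriv

variable {E F : Type*} [NormedAddCommGroup E] [NormedSpace ℝ E] [NormedAddCommGroup F]
  [NormedSpace ℝ F] {T : Set ℝ} {t : ℝ} {f g : ℝ → E} {f' g' : E}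

theorem HasDeltaDerivAt.add (hf : HasDeltaDerivAt T f f' t) (hg : HasDeltaDerivAt T g g' t) :
    HasDeltaDerivAt T (fun s => f s + g s) (f' + g') t := by
  intro ε hε
  filter_upwards [hf (ε / 2) (half_pos hε), hg (ε / 2) (half_pos hε)] with s h1 h2
  calc _ = ‖(f (sigma T t) - f s - (sigma T t - s) • f')
        + (g (sigma T t) - g s - (sigma T t - s) • g')‖ := by
        congr 1; rw [smul_add]; abel
    _ ≤ _ := (norm_add_le _ _).trans (add_le_add h1 h2)
    _ = _ := by ring

theorem HasDeltaDerivAt.clm_comp (L : E →L[ℝ] F) (hf : HasDeltaDerivAt T f f' t) :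
    HasDeltaDerivAt T (fun s => L (f s)) (L f') t := by
  intro ε hε
  have hL : 0 < ‖L‖ + 1 := by positivity
  filter_upwards [hf (ε / (‖L‖ + 1)) (by positivity)] with s h1
  calc _ = ‖L (f (sigma T t) - f s - (sigma T t - s) • f')‖ := by simp
    _ ≤ ‖L‖ * (ε / (‖L‖ + 1) * |sigma T t - s|) := L.le_opNorm_of_le h1
    _ ≤ (‖L‖ + 1) * (ε / (‖L‖ + 1) * |sigma T t - s|) := by gcongr; linarith
    _ = _ := by field_simp

theorem HasDeltaDerivAt.const_smul (c : ℝ) (hf : HasDeltaDerivAt T f f' t) :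
    HasDeltaDerivAt T (fun s => c • f s) (c • f') t :=
  hf.clm_comp (c • ContinuousLinearMap.id ℝ E)

theorem HasDeltaDerivAt.sub (hf : HasDeltaDerivAt T f f' t) (hg : HasDeltaDerivAt T g g' t) :
    HasDeltaDerivAt T (fun s => f s - g s) (f' - g') t := by
  simpa [sub_eq_add_neg] using hf.add (hg.const_smul (-1))

theorem hasDeltaDerivAt_const (c : E) : HasDeltaDerivAt T (fun _ => c) (0 : E) t := by
  intro ε hε
  filter_upwards with s
  simpa using by positivity

/-- The point s = t is itself admissible in the definition, and ε is arbitrary. -/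
theorem HasDeltaDerivAt.sigma_eq (ht : t ∈ T) (hf : HasDeltaDerivAt T f f' t) :
    f (sigma T t) = f t + (sigma T t - t) • f' := by
  have h : ‖f (sigma T t) - f t - (sigma T t - t) • f'‖ ≤ 0 := by
    refine le_of_forall_pos_le_add fun ε hε => ?_
    have h1 := (hf (ε / (|sigma T t - t| + 1)) (by positivity)).self_of_nhdsWithin ht
    refine h1.trans ?_
    rw [zero_add, div_mul_eq_mul_div, div_le_iff₀ (by positivity)]
    nlinarith [abs_nonneg (sigma T t - t)]
  have := norm_le_zero_iff.1 h
  rw [sub_sub, sub_eq_zero] at this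
  exact this

theorem HasDeltaDerivAt.continuousWithinAt (ht : t ∈ T) (hf : HasDeltaDerivAt T f f' t) :
    ContinuousWithinAt f T t := by
  have hlim2 : Tendsto (fun s : ℝ => |s - t| * ‖f'‖) (𝓝[T] t) (𝓝 (|t - t| * ‖f'‖)) :=
    (Continuous.tendsto (by fun_prop) t).mono_left nhdsWithin_le_nhds
  rw [ContinuousWithinAt, Metric.tendsto_nhds]
  intro ε hε
  set K := |sigma T t - t| + 1 with hK
  have hKpos : 0 < K := by positivity
  have hlim3 : Tendsto (fun s : ℝ => |sigma T t - s|) (𝓝[T] t) (𝓝 |sigma T t - t|) :=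
    (Continuous.tendsto (by fun_prop) t).mono_left nhdsWithin_le_nhds
  filter_upwards [hf (ε / 2 / K) (by positivity), hlim3.eventually_lt_const (lt_add_one _),
    hlim2.eventually_lt_const (u := ε / 2) (by simpa using half_pos hε)] with s h1 h2 h3
  rw [dist_eq_norm]
  have e : f s - f t = -(f (sigma T t) - f s - (sigma T t - s) • f') + (s - t) • f' +
      (f (sigma T t) - f t - (sigma T t - t) • f') := by
    module
  have e2 : f (sigma T t) - f t - (sigma T t - t) • f' = 0 := by
    rw [hf.sigma_eq ht]; abel
  rw [e, e2, add_zero]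
  calc _ ≤ ‖f (sigma T t) - f s - (sigma T t - s) • f'‖ + |s - t| * ‖f'‖ := by
        refine (norm_add_le _ _).trans ?_
        rw [norm_neg, norm_smul, Real.norm_eq_abs]
    _ < ε / 2 / K * K + ε / 2 := by
        refine add_lt_add_of_le_of_lt (h1.trans ?_) h3
        gcongr
    _ = ε := by field_simp; ring

/-- A function that vanishes to the right of `t` has delta derivative zero. -/
theorem HasDeltaDerivAt.eq_zero (hu : ¬ BddAbove T) (ht : t ∈ T)
    (hf : HasDeltaDerivAt T f f' t) {r : ℝ} (htr : t < r) (hσ : sigma T t < r)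
    (h0 : ∀ s ∈ T, t ≤ s → s < r → f s = 0) (hσT : sigma T t ∈ T) : f' = 0 := by
  have hfσ : f (sigma T t) = 0 := h0 _ hσT (le_sigma hu t) hσ
  rcases (le_sigma hu t).eq_or_lt with h | h
  · rw [← norm_le_zero_iff]
    refine le_of_forall_pos_le_add fun ε hε => ?_
    obtain ⟨u, hu', hsub⟩ := mem_nhdsWithin_iff_exists_mem_nhds_inter.1 (hf ε hε)
    obtain ⟨δ, hδ, hball⟩ := Metric.mem_nhds_iff.1 hu'
    obtain ⟨s, hs, hts, hsr⟩ :=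
      exists_mem_Ioo_of_sigma_eq hu h.symm (lt_min htr (lt_add_of_pos_right t hδ))
    have hsu : s ∈ u := hball (by
      rw [Metric.mem_ball, Real.dist_eq, abs_of_pos (sub_pos.2 hts)]
      linarith [hsr.trans_le (min_le_right _ _)])
    have h1 : ‖f (sigma T t) - f s - (sigma T t - s) • f'‖ ≤ ε * |sigma T t - s| := hsub ⟨hsu, hs⟩
    rw [hfσ, h0 s hs hts.le (hsr.trans_le (min_le_left _ _)), sub_zero, zero_sub, norm_neg,
      norm_smul, Real.norm_eq_abs, mul_comm ε, ← h] at h1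
    rw [zero_add]
    exact le_of_mul_le_mul_left h1 (abs_pos.2 (by linarith))
  · have h1 := hf.sigma_eq ht
    rw [hfσ, h0 t ht le_rfl htr, zero_add, eq_comm, smul_eq_zero] at h1
    exact h1.resolve_left (by linarith)

/-- Forward uniqueness: Gronwall's inequality with zero initial value. -/
theorem eq_zero_of_norm_deltaDeriv_le {t₀ : ℝ} (hc : IsClosed T) (hu : ¬ BddAbove T)
    (ht₀ : IsLeast T t₀) {d : ℝ → E} (hf : ∀ t ∈ T, HasDeltaDerivAt T f (d t) t) {L : ℝ}
    (hL : 0 < L) (hd : ∀ t ∈ T, ‖d t‖ ≤ L * ‖f t‖) (h0 : f t₀ = 0) : ∀ t ∈ T, f t = 0 := by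
  -- Comparison with the barrier ε exp(2Lt). Of the rate 2L, one L pays for the bound on the
  -- derivative, the other for the differentiation error at right-dense points.
  have key : ∀ ε > 0, ∀ t ∈ T, ‖f t‖ ≤ ε * Real.exp (2 * L * t) := by
    intro ε hε
    have step : ∀ t s, t ≤ s → ε * Real.exp (2 * L * t) * (1 + 2 * L * (s - t)) ≤
        ε * Real.exp (2 * L * s) := by
      intro t s hts
      have : Real.exp (2 * L * s) = Real.exp (2 * L * t) * Real.exp (2 * L * (s - t)) := by
        rw [← Real.exp_add]; ring_nf
      rw [this, ← mul_assoc]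
      gcongr
      linarith [Real.add_one_le_exp (2 * L * (s - t))]
    refine timeScale_induction hc hu ht₀ ?_ ?_ ?_ ?_
    · rw [h0, norm_zero]; positivity
    · intro t ht hP
      refine le_trans ?_ (step t _ (le_sigma hu t))
      rw [(hf t ht).sigma_eq ht]
      have hμ : 0 ≤ sigma T t - t := sub_nonneg.2 (le_sigma hu t)
      refine (norm_add_le _ _).trans ?_
      rw [norm_smul, Real.norm_of_nonneg hμ]
      have := mul_le_mul_of_nonneg_left (hd t ht) hμ
      have h2 : L * ‖f t‖ ≤ L * (ε * Real.exp (2 * L * t)) := by gcongr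
      have h3 := mul_le_mul_of_nonneg_left h2 hμ
      have h4 : 0 ≤ (sigma T t - t) * (L * (ε * Real.exp (2 * L * t))) := by positivity
      nlinarith
    · intro t ht hσ hP
      set M := ε * Real.exp (2 * L * t) with hM
      have hMpos : 0 < M := by positivity
      obtain ⟨u, hu', hsub⟩ :=
        mem_nhdsWithin_iff_exists_mem_nhds_inter.1 (hf t ht (L * M) (by positivity))
      obtain ⟨δ, hδ, hball⟩ := Metric.mem_nhds_iff.1 hu'
      refine ⟨t + δ, by linarith, fun s hs hts hsr => le_trans ?_ (step t s hts.le)⟩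
      have hsu : s ∈ u := hball (by
        rw [Metric.mem_ball, Real.dist_eq, abs_of_pos (sub_pos.2 hts)]
        linarith)
      have h1 : ‖f (sigma T t) - f s - (sigma T t - s) • d t‖ ≤ L * M * |sigma T t - s| :=
        hsub ⟨hsu, hs⟩
      rw [hσ, abs_sub_comm, abs_of_pos (sub_pos.2 hts)] at h1
      have e : f s = f t + (s - t) • d t - (f t - f s - (t - s) • d t) := by module
      have h2 : ‖d t‖ ≤ L * M := (hd t ht).trans (by gcongr)
      calc ‖f s‖ ≤ ‖f t‖ + (s - t) * ‖d t‖ + ‖f t - f s - (t - s) • d t‖ := by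
            conv_lhs => rw [e]
            refine (norm_sub_le _ _).trans ?_
            gcongr
            refine (norm_add_le _ _).trans ?_
            rw [norm_smul, Real.norm_of_nonneg (sub_nonneg.2 hts.le)]
        _ ≤ M + (s - t) * (L * M) + L * M * (s - t) := by
            gcongr
        _ = _ := by ring
    · intro t ht hld hs
      have hcont := ((hf t ht).continuousWithinAt ht).mono (inter_subset_left (t := Iio t))
      have : (𝓝[T ∩ Iio t] t).NeBot := by
        rw [← mem_closure_iff_nhdsWithin_neBot, Metric.mem_closure_iff]
        intro δ hδ
        obtain ⟨s, hs, h1, h2⟩ := hld (t - δ) (by linarith)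
        exact ⟨s, ⟨hs, h2⟩, by rw [Real.dist_eq, abs_of_pos (by linarith)]; linarith⟩
      refine le_of_tendsto_of_tendsto hcont.norm
        ((Continuous.tendsto (f := fun s => ε * Real.exp (2 * L * s)) (by fun_prop) t).mono_left
          nhdsWithin_le_nhds) ?_
      filter_upwards [self_mem_nhdsWithin] with s hsm using hs s hsm.1 hsm.2
  intro t ht
  rw [← norm_le_zero_iff]
  refine le_of_forall_pos_le_add fun ε hε => ?_
  have := key (ε / Real.exp (2 * L * t)) (by positivity) t ht
  rwa [div_mul_cancel₀ _ (Real.exp_pos _).ne', ← zero_add ε] at this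

end DeltaDeriv

end TimeScale

/-! ### Delta integrals and generalized monomials -/

namespace TimeScale

open Set Filter MeasureTheory

/-- The last point of `T` that is at most `max s t₀`. -/
noncomputable def lastPoint (T : Set ℝ) (t₀ s : ℝ) : ℝ := sSup (T ∩ Iic (max s t₀))

/-- The generalized monomials `h_k(·, t₀)` of the time scale `T`, extended to `ℝ`. -/
noncomputable def genMonomial (T : Set ℝ) (t₀ : ℝ) : ℕ → ℝ → ℝ
  | 0 => fun _ => 1
  | k + 1 => fun t => ∫ s in t₀..t, genMonomial T t₀ k (lastPoint T t₀ s)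

section LastPoint

variable {T : Set ℝ} {t₀ : ℝ}

theorem lastPoint_mem_inter (hc : IsClosed T) (ht₀ : IsLeast T t₀) (s : ℝ) :
    lastPoint T t₀ s ∈ T ∩ Iic (max s t₀) :=
  (hc.inter isClosed_Iic).csSup_mem ⟨t₀, ht₀.1, mem_Iic.2 (le_max_right _ _)⟩ ⟨_, fun _ h => h.2⟩

theorem le_lastPoint {t s : ℝ} (ht : t ∈ T) (h : t ≤ s) : t ≤ lastPoint T t₀ s :=
  le_csSup ⟨_, fun _ h => h.2⟩ ⟨ht, h.trans (le_max_left _ _)⟩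

theorem lastPoint_mono (ht₀ : IsLeast T t₀) : Monotone (lastPoint T t₀) := fun _ _ h =>
  csSup_le_csSup ⟨_, fun _ h => h.2⟩ ⟨t₀, ht₀.1, mem_Iic.2 (le_max_right _ _)⟩
    (inter_subset_inter_right _ (Iic_subset_Iic.2 (max_le_max_right _ h)))

theorem lastPoint_mem_Icc (hc : IsClosed T) (ht₀ : IsLeast T t₀) (s : ℝ) :
    lastPoint T t₀ s ∈ Icc t₀ (max s t₀) :=
  ⟨ht₀.2 (lastPoint_mem_inter hc ht₀ s).1, (lastPoint_mem_inter hc ht₀ s).2⟩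

theorem lastPoint_le (hc : IsClosed T) (ht₀ : IsLeast T t₀) {s : ℝ} (hs : t₀ ≤ s) :
    lastPoint T t₀ s ≤ s := by
  simpa [hs] using (lastPoint_mem_Icc hc ht₀ s).2

theorem abs_lastPoint_sub_le (hc : IsClosed T) (ht₀ : IsLeast T t₀) (s : ℝ) :
    |lastPoint T t₀ s - t₀| ≤ |s - t₀| := by
  have h := lastPoint_mem_Icc hc ht₀ s
  rw [abs_of_nonneg (sub_nonneg.2 h.1)]
  rcases le_total t₀ s with hs | hs
  · rw [max_eq_left hs] at h
    exact (sub_le_sub_right h.2 _).trans (le_abs_self _)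
  · rw [max_eq_right hs] at h
    linarith [h.2, abs_nonneg (s - t₀)]

theorem lastPoint_eq (hc : IsClosed T) (ht₀ : IsLeast T t₀) {t r : ℝ} (ht : t ∈ T)
    (h : t ≤ r) (hr : r < sigma T t) : lastPoint T t₀ r = t := by
  refine le_antisymm (not_lt.1 fun hlt => ?_) (le_lastPoint ht h)
  have h1 := sigma_le (lastPoint_mem_inter hc ht₀ r).1 hlt
  exact absurd (h1.trans (lastPoint_le hc ht₀ ((ht₀.2 ht).trans h))) (not_le.2 hr)

end LastPoint

section Primitive

variable {E : Type*} [NormedAddCommGroup E] {T : Set ℝ} {t₀ : ℝ} {f : ℝ → E}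

/-- `lastPoint` is monotone, hence measurable, and keeps bounded intervals bounded. -/
theorem intervalIntegrable_comp_lastPoint (hc : IsClosed T) (ht₀ : IsLeast T t₀)
    (hf : Continuous f) (a b : ℝ) :
    IntervalIntegrable (fun s => f (lastPoint T t₀ s)) volume a b := by
  obtain ⟨M, hM⟩ := (isCompact_Icc (a := t₀) (b := max (max a b) t₀)).exists_bound_of_continuousOn
    hf.continuousOn
  refine (intervalIntegrable_const (c := M)).mono_fun'
    ((hf.stronglyMeasurable.comp_measurable (lastPoint_mono ht₀).measurable).aestronglyMeasurable) ?_
  refine (ae_restrict_iff' measurableSet_uIoc).2 (ae_of_all _ fun s hs => hM _ ?_)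
  have h := lastPoint_mem_Icc hc ht₀ s
  exact ⟨h.1, h.2.trans (max_le_max_right _ hs.2)⟩

variable [NormedSpace ℝ E] [CompleteSpace E]

/-- The delta integral of a continuous function is a delta antiderivative. -/
theorem hasDeltaDerivAt_integral (hc : IsClosed T) (hu : ¬ BddAbove T) (ht₀ : IsLeast T t₀)
    (hf : Continuous f) {t : ℝ} (ht : t ∈ T) :
    HasDeltaDerivAt T (fun t => ∫ s in t₀..t, f (lastPoint T t₀ s)) (f t) t := by
  intro ε hε
  obtain ⟨δ, hδ, hball⟩ := Metric.continuousAt_iff.1 hf.continuousAt ε hε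
  have hint := intervalIntegrable_comp_lastPoint hc ht₀ hf
  have hσ := le_sigma hu t
  have hev : ∀ᶠ s in 𝓝[T] t, dist s t < δ ∧ (t < sigma T t → s < sigma T t) := by
    refine mem_nhdsWithin_of_mem_nhds (Filter.inter_mem (Metric.ball_mem_nhds t hδ) ?_)
    by_cases h : t < sigma T t
    · filter_upwards [Iio_mem_nhds h] with s hs _ using hs
    · filter_upwards with s h' using absurd h' h
  filter_upwards [hev, self_mem_nhdsWithin] with s ⟨hs1, hs2⟩ hsT
  -- Across the gap after t the integrand is frozen at f t, except at the null endpoint σ(t). So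
  -- only the integral between s and t contributes to the error.
  have hz : ∫ r in t..sigma T t, (f (lastPoint T t₀ r) - f t) = 0 := by
    rw [intervalIntegral.integral_of_le hσ, integral_Ioc_eq_integral_Ioo]
    refine setIntegral_eq_zero_of_forall_eq_zero fun r hr => ?_
    rw [lastPoint_eq hc ht₀ ht hr.1.le hr.2, sub_self]
  have e : (∫ r in t₀..sigma T t, f (lastPoint T t₀ r)) - (∫ r in t₀..s, f (lastPoint T t₀ r))
      - (sigma T t - s) • f t = ∫ r in s..t, (f (lastPoint T t₀ r) - f t) := by
    have hi : ∀ a b, IntervalIntegrable (fun r => f (lastPoint T t₀ r) - f t) volume a b :=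
      fun a b => (hint a b).sub intervalIntegrable_const
    rw [← add_zero (∫ r in s..t, (f (lastPoint T t₀ r) - f t)), ← hz,
      intervalIntegral.integral_add_adjacent_intervals (hi _ _) (hi _ _),
      intervalIntegral.integral_sub (hint _ _) intervalIntegrable_const,
      intervalIntegral.integral_const,
      intervalIntegral.integral_interval_sub_left (hint _ _) (hint _ _)]
  rw [e]
  have hbound : ‖∫ r in s..t, (f (lastPoint T t₀ r) - f t)‖ ≤ ε * |t - s| := by
    refine intervalIntegral.norm_integral_le_of_norm_le_const fun r hr => ?_
    rw [← dist_eq_norm]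
    refine (hball ?_).le
    have hst₀ := ht₀.2 hsT
    have htt₀ := ht₀.2 ht
    rw [Real.dist_eq] at hs1 ⊢
    rcases le_total s t with hst | hst
    · rw [uIoc_of_le hst] at hr
      have h1 := le_lastPoint (t₀ := t₀) hsT hr.1.le
      have h2 := lastPoint_le hc ht₀ (hst₀.trans hr.1.le)
      rw [abs_lt] at hs1 ⊢
      constructor <;> linarith [hr.2]
    · rw [uIoc_of_ge hst] at hr
      have h1 := le_lastPoint (t₀ := t₀) ht hr.1.le
      have h2 := lastPoint_le hc ht₀ (htt₀.trans hr.1.le)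
      rw [abs_lt] at hs1 ⊢
      constructor <;> linarith [hr.2]
  refine hbound.trans (mul_le_mul_of_nonneg_left ?_ hε.le)
  -- The bound in |t - s| suffices: if t is right-scattered, nearby points s of T satisfy s ≤ t,
  -- hence |t - s| ≤ |σ(t) - s|.
  rcases hσ.eq_or_lt with h | h
  · rw [← h]
  · rcases le_total s t with hst | hst
    · rw [abs_of_nonneg (sub_nonneg.2 hst), abs_of_nonneg (sub_nonneg.2 (hst.trans hσ))]
      linarith
    · rcases hst.eq_or_lt with h' | h'
      · rw [h', sub_self, abs_zero]; positivity
      · exact absurd (hs2 h) (not_lt.2 (sigma_le hsT h'))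

end Primitive

section GenMonomial

variable {T : Set ℝ} {t₀ : ℝ}

theorem continuous_genMonomial (hc : IsClosed T) (ht₀ : IsLeast T t₀) (k : ℕ) :
    Continuous (genMonomial T t₀ k) := by
  induction k with
  | zero => exact continuous_const
  | succ k ih =>
    exact intervalIntegral.continuous_primitive (intervalIntegrable_comp_lastPoint hc ht₀ ih) t₀

theorem genMonomial_self (k : ℕ) : genMonomial T t₀ (k + 1) t₀ = 0 := by
  simp [genMonomial]

theorem genMonomial_nonneg (hc : IsClosed T) (ht₀ : IsLeast T t₀) (k : ℕ) {t : ℝ}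
    (ht : t₀ ≤ t) : 0 ≤ genMonomial T t₀ k t := by
  induction k generalizing t with
  | zero => exact zero_le_one
  | succ k ih =>
    exact intervalIntegral.integral_nonneg ht fun s _ => ih (lastPoint_mem_Icc hc ht₀ s).1

/-- The last point before s is no farther from t₀ than s, so each integration is dominated by the
one for ordinary monomials. -/
theorem abs_genMonomial_le (hc : IsClosed T) (ht₀ : IsLeast T t₀) (k : ℕ) (t : ℝ) :
    |genMonomial T t₀ k t| ≤ |t - t₀| ^ k / k.factorial := by
  induction k generalizing t with
  | zero => simp [genMonomial]
  | succ k ih =>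
    have h1 : ∀ s, ‖genMonomial T t₀ k (lastPoint T t₀ s)‖ ≤ |s - t₀| ^ k / k.factorial :=
      fun s => (ih _).trans (by have := abs_lastPoint_sub_le hc ht₀ s; gcongr)
    have h2 : |genMonomial T t₀ (k + 1) t| ≤ ∫ s in uIoc t₀ t, |s - t₀| ^ k / k.factorial := by
      rw [← Real.norm_eq_abs]
      refine (intervalIntegral.norm_integral_le_integral_norm_uIoc).trans ?_
      refine setIntegral_mono_on ?_ ?_ measurableSet_uIoc fun s _ => h1 s
      · exact intervalIntegrable_iff.1
          (intervalIntegrable_comp_lastPoint hc ht₀ (continuous_genMonomial hc ht₀ k) t₀ t).norm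
      · exact intervalIntegrable_iff.1
          (Continuous.intervalIntegrable (by fun_prop) t₀ t)
    refine h2.trans (le_of_eq ?_)
    rw [integral_div, integral_pow_abs_sub_uIoc, Nat.factorial_succ]
    push_cast
    field_simp

/-- Past t₁ the last point stays at or beyond t₁, so the integrand is positive on (t₁, t₂).
Positivity can fail near t₀: on the integers h_k(t, 0) is a binomial coefficient, zero for 0 ≤ t <
k. -/
theorem genMonomial_pos_of_le (hc : IsClosed T) (ht₀ : IsLeast T t₀) (k : ℕ) {t₁ t₂ : ℝ}
    (h₁ : t₁ ∈ T) (h : t₁ < t₂) (hpos : ∀ t, t₁ ≤ t → 0 < genMonomial T t₀ k t) :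
    0 < genMonomial T t₀ (k + 1) t₂ := by
  have hint := intervalIntegrable_comp_lastPoint hc ht₀ (continuous_genMonomial hc ht₀ k)
  change 0 < ∫ s in t₀..t₂, genMonomial T t₀ k (lastPoint T t₀ s)
  rw [← intervalIntegral.integral_add_adjacent_intervals (hint t₀ t₁) (hint t₁ t₂)]
  refine add_pos_of_nonneg_of_pos (genMonomial_nonneg hc ht₀ (k + 1) (ht₀.2 h₁)) ?_
  exact intervalIntegral.intervalIntegral_pos_of_pos_on (hint _ _)
    (fun s hs => hpos _ (le_lastPoint h₁ hs.1.le)) h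

/-- Far enough to the right of `t₀` the generalized monomial `h_k` is positive. -/
theorem exists_genMonomial_pos (hc : IsClosed T) (hu : ¬ BddAbove T) (ht₀ : IsLeast T t₀)
    (k : ℕ) : ∃ t₁ ∈ T, ∀ t, t₁ ≤ t → 0 < genMonomial T t₀ k t := by
  induction k with
  | zero => exact ⟨t₀, ht₀.1, fun t _ => one_pos⟩
  | succ k ih =>
    obtain ⟨t₁, h₁, hpos⟩ := ih
    obtain ⟨t₂, h₂, h⟩ := not_bddAbove_iff.1 hu t₁
    exact ⟨t₂, h₂, fun t ht => genMonomial_pos_of_le hc ht₀ k h₁ (h.trans_le ht) hpos⟩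

end GenMonomial

/-! ### Generalized power series -/

section Series

variable {E : Type*} [NormedAddCommGroup E] [NormedSpace ℝ E]
  {T : Set ℝ} {t₀ : ℝ} {c : ℕ → E} {K r : ℝ}

theorem summable_pow_div_factorial_mul (R K r : ℝ) :
    Summable fun k : ℕ => R ^ k / k.factorial * (K * r ^ k) := by
  refine ((Real.summable_pow_div_factorial (R * r)).mul_left K).congr fun k => ?_
  rw [mul_pow]; ring

theorem norm_genMonomial_smul_le (hc : IsClosed T) (ht₀ : IsLeast T t₀)
    (hcK : ∀ k, ‖c k‖ ≤ K * r ^ k) {R t : ℝ} (ht : |t - t₀| ≤ R) (k : ℕ) :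
    ‖genMonomial T t₀ k t • c k‖ ≤ R ^ k / k.factorial * (K * r ^ k) := by
  rw [norm_smul, Real.norm_eq_abs]
  refine mul_le_mul ?_ (hcK k) (norm_nonneg _) (by have := (abs_nonneg _).trans ht; positivity)
  exact (abs_genMonomial_le hc ht₀ k t).trans (by gcongr)

theorem tsum_genMonomial_smul_self (c : ℕ → E) : ∑' k, genMonomial T t₀ k t₀ • c k = c 0 := by
  rw [tsum_eq_single 0]
  · simp [genMonomial]
  · intro k hk
    obtain ⟨k, rfl⟩ := Nat.exists_eq_succ_of_ne_zero hk
    rw [Nat.succ_eq_add_one, genMonomial_self, zero_smul]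

variable [CompleteSpace E]

theorem summable_genMonomial_smul (hc : IsClosed T) (ht₀ : IsLeast T t₀)
    (hcK : ∀ k, ‖c k‖ ≤ K * r ^ k) (t : ℝ) : Summable fun k => genMonomial T t₀ k t • c k :=
  .of_norm_bounded (summable_pow_div_factorial_mul _ K r)
    (norm_genMonomial_smul_le hc ht₀ hcK le_rfl)

theorem continuous_tsum_genMonomial_smul (hc : IsClosed T) (ht₀ : IsLeast T t₀)
    (hcK : ∀ k, ‖c k‖ ≤ K * r ^ k) : Continuous fun t => ∑' k, genMonomial T t₀ k t • c k := by
  rw [continuous_iff_continuousAt]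
  intro t
  refine (continuousOn_tsum (s := Metric.ball t₀ (|t - t₀| + 1))
    (fun k => ((continuous_genMonomial hc ht₀ k).smul continuous_const).continuousOn)
    (summable_pow_div_factorial_mul _ K r) fun k s hs =>
      norm_genMonomial_smul_le hc ht₀ hcK (by simpa [Real.dist_eq] using (Metric.mem_ball.1 hs).le) k
    ).continuousAt (Metric.isOpen_ball.mem_nhds ?_)
  rw [Metric.mem_ball, Real.dist_eq]
  linarith

/-- Termwise delta differentiation of the generalized power series `∑ h_k c_k`. -/
theorem hasDeltaDerivAt_tsum_genMonomial_smul (hc : IsClosed T) (hu : ¬ BddAbove T)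
    (ht₀ : IsLeast T t₀) (hcK : ∀ k, ‖c k‖ ≤ K * r ^ k) {t : ℝ} (ht : t ∈ T) :
    HasDeltaDerivAt T (fun t => ∑' k, genMonomial T t₀ k t • c k)
      (∑' k, genMonomial T t₀ k t • c (k + 1)) t := by
  have hcK' : ∀ k, ‖c (k + 1)‖ ≤ K * r * r ^ k := fun k => by
    have := hcK (k + 1)
    rwa [pow_succ', ← mul_assoc] at this
  have hcont := continuous_tsum_genMonomial_smul hc ht₀ hcK'
  -- Each h_{k+1} is the delta integral of h_k, so exchanging sum and integral (dominated
  -- convergence) writes the series as a delta integral.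
  have e : (fun t => ∑' k, genMonomial T t₀ k t • c k) = fun t => c 0 +
      ∫ s in t₀..t, ∑' k, genMonomial T t₀ k (lastPoint T t₀ s) • c (k + 1) := by
    funext t
    rw [(summable_genMonomial_smul hc ht₀ hcK t).tsum_eq_zero_add]
    congr 1
    · simp [genMonomial]
    have := intervalIntegral.hasSum_integral_of_dominated_convergence (μ := volume)
      (a := t₀) (b := t) (F := fun k s => genMonomial T t₀ k (lastPoint T t₀ s) • c (k + 1))
      (f := fun s => ∑' k, genMonomial T t₀ k (lastPoint T t₀ s) • c (k + 1))
      (fun k _ => |t - t₀| ^ k / k.factorial * (K * r * r ^ k))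
      (fun k => (((continuous_genMonomial hc ht₀ k).smul
        (continuous_const (y := c (k + 1)))).stronglyMeasurable.comp_measurable
        (lastPoint_mono ht₀).measurable).aestronglyMeasurable)
      (fun k => ae_of_all _ fun s hs => norm_genMonomial_smul_le (c := fun k => c (k + 1)) hc ht₀ hcK'
        ((abs_lastPoint_sub_le hc ht₀ s).trans (abs_sub_left_of_mem_uIcc (uIoc_subset_uIcc hs))) k)
      (ae_of_all _ fun s _ => summable_pow_div_factorial_mul _ _ r) intervalIntegrable_const
      (ae_of_all _ fun s _ =>
        (summable_genMonomial_smul (c := fun k => c (k + 1)) hc ht₀ hcK' _).hasSum)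
    rw [← this.tsum_eq]
    refine tsum_congr fun k => ?_
    rw [intervalIntegral.integral_smul_const]
    rfl
  rw [e]
  simpa using (hasDeltaDerivAt_const (c 0)).add (hasDeltaDerivAt_integral hc hu ht₀ hcont ht)

end Series

end TimeScale

/-! ### Vanishing of coefficients from shifted sums -/

namespace TimeScale

open Set Filter

/-- A positive tail of a sequence dominated by `R ^ i / i!` has an index after which it decays
geometrically with any prescribed ratio. -/
theorem exists_geometric_decay {h : ℕ → ℝ} {R : ℝ} (hnn : ∀ i, 0 ≤ h i)
    (hR : ∀ i, h i ≤ R ^ i / i.factorial) {N j : ℕ} (hj : j ≤ N) (hN : 0 < h N) {δ : ℝ}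
    (hδ : 0 < δ) : ∃ i ≥ j, 0 < h i ∧ ∀ q, h (i + q) ≤ h i * δ ^ q := by
  have hlim : Tendsto (fun i => h i / δ ^ i) atTop (𝓝 0) := by
    refine squeeze_zero (fun i => div_nonneg (hnn i) (by positivity)) (fun i => ?_)
      (FloorSemiring.tendsto_pow_div_factorial_atTop (R / δ))
    rw [div_pow, div_div, mul_comm, ← div_div]
    gcongr
    exact hR i
  obtain ⟨M, hM⟩ := eventually_atTop.1
    (hlim.eventually_lt_const (u := h N / δ ^ N) (by positivity))
  -- Past M the ratio h i / δ ^ i stays below its value at N, so a maximum over this finite range is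
  -- a maximum over all indices ≥ j.
  obtain ⟨i, hi, hmax⟩ := Finset.exists_max_image (Finset.Icc j (max M N)) (fun i => h i / δ ^ i)
    ⟨N, Finset.mem_Icc.2 ⟨hj, le_max_right _ _⟩⟩
  have hNi := hmax N (Finset.mem_Icc.2 ⟨hj, le_max_right _ _⟩)
  have hall : ∀ l ≥ j, h l / δ ^ l ≤ h i / δ ^ i := fun l hl => by
    by_cases hlM : l ≤ max M N
    · exact hmax l (Finset.mem_Icc.2 ⟨hl, hlM⟩)
    · exact (hM l ((le_max_left _ _).trans (not_le.1 hlM).le)).le.trans hNi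
  have hji := (Finset.mem_Icc.1 hi).1
  refine ⟨i, hji, ?_, fun q => ?_⟩
  · have : 0 < h i / δ ^ i := lt_of_lt_of_le (by positivity) hNi
    exact (div_pos_iff_of_pos_right (by positivity)).1 this
  · have := hall (i + q) (by omega)
    rw [div_le_div_iff₀ (by positivity) (by positivity), pow_add] at this
    have hp : 0 < δ ^ i := by positivity
    refine le_of_mul_le_mul_right ?_ hp
    linarith

/-- Induction on j. Once the earlier g vanish, a suitable shift puts g j in front with a weight h i
from which h decays arbitrarily fast. The tail is then arbitrarily small relative to h i, so g j
must be 0. Positivity of h N provides a nonzero weight at an index beyond j. -/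
theorem eq_zero_of_forall_tsum_shift_eq_zero {h g : ℕ → ℝ} {R K r : ℝ} (hnn : ∀ i, 0 ≤ h i)
    (hR : ∀ i, h i ≤ R ^ i / i.factorial) (hr : 0 < r) (hg : ∀ j, |g j| ≤ K * r ^ j)
    (hsum : ∀ k, ∑' j, h (k + 1 + j) * g j = 0) {N : ℕ} (hN : 0 < h N) :
    ∀ j < N, g j = 0 := by
  intro j
  induction j using Nat.strong_induction_on with
  | _ j ih =>
  intro hj
  have key : ∀ x, 0 < x → x ≤ 1 / 2 → |g j| ≤ 2 * (K * r ^ j) * x := by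
    intro x hx hx2
    -- Decay ratio x / r cancels the growth r ^ q of g and leaves x ^ q.
    obtain ⟨i, hi, hipos, hdecay⟩ :=
      exists_geometric_decay hnn hR (Nat.succ_le_of_lt hj) hN (div_pos hx hr)
    have hb : ∀ q, ‖h (i + q) * g (j + q)‖ ≤ h i * (K * r ^ j) * x ^ q := fun q => by
      rw [Real.norm_eq_abs, abs_mul, abs_of_nonneg (hnn _)]
      calc _ ≤ (h i * (x / r) ^ q) * (K * r ^ (j + q)) :=
            mul_le_mul (hdecay q) (hg _) (abs_nonneg _) (by positivity)
        _ = _ := by rw [div_pow, pow_add]; field_simp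
    have hx1 : x < 1 := by linarith
    have hs : Summable fun q => h (i + q) * g (j + q) :=
      .of_norm_bounded ((summable_geometric_of_lt_one hx.le hx1).mul_left _) hb
    have hs' : Summable fun l => h (i - (j + 1) + 1 + l) * g l := by
      rw [← summable_nat_add_iff j]
      refine hs.congr fun q => ?_
      congr 2 <;> omega
    -- This shift gives the term g j the weight h i; it is legitimate because i ≥ j + 1.
    have h0 := hsum (i - (j + 1))
    rw [← hs'.sum_add_tsum_nat_add j, Finset.sum_eq_zero, zero_add] at h0
    swap
    · intro l hl
      have hl' := Finset.mem_range.1 hl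
      rw [ih l hl' (hl'.trans hj), mul_zero]
    have h1 : ∑' q, h (i + q) * g (j + q) = 0 := by
      rw [← h0]
      refine tsum_congr fun q => ?_
      congr 2 <;> omega
    rw [hs.tsum_eq_zero_add, add_zero, add_zero] at h1
    have h2 : ‖∑' q, h (i + (q + 1)) * g (j + (q + 1))‖ ≤
        h i * (K * r ^ j) * x * (1 - x)⁻¹ := by
      refine tsum_of_norm_bounded ((hasSum_geometric_of_lt_one hx.le hx1).mul_left _) fun q => ?_
      refine (hb (q + 1)).trans (le_of_eq ?_)
      rw [pow_succ]; ring
    rw [← neg_eq_of_add_eq_zero_right h1, norm_neg, Real.norm_eq_abs, abs_mul,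
      abs_of_pos hipos, mul_assoc, mul_assoc] at h2
    have h3 := le_of_mul_le_mul_left h2 hipos
    have hK : 0 ≤ K * r ^ j := (abs_nonneg _).trans (hg j)
    have h4 : (1 - x)⁻¹ ≤ 2 := by
      rw [inv_le_comm₀ (by linarith) two_pos]; linarith
    calc _ ≤ K * r ^ j * (x * (1 - x)⁻¹) := h3
      _ ≤ K * r ^ j * (x * 2) := by gcongr
      _ = _ := by ring
  by_contra hne
  have ha : 0 < |g j| := abs_pos.2 hne
  set D := 2 * (K * r ^ j) with hD
  have hDnn : 0 ≤ D := by linarith [(abs_nonneg _).trans (hg j)]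
  -- This x makes the bound D * x strictly smaller than |g j|.
  have h1 := key (min (1 / 2) (|g j| / (2 * (D + 1)))) (by positivity) (min_le_left _ _)
  have h2 : D * min (1 / 2) (|g j| / (2 * (D + 1))) ≤ D * (|g j| / (2 * (D + 1))) := by
    gcongr; exact min_le_right _ _
  have h3 : D * (|g j| / (2 * (D + 1))) < |g j| := by
    rw [← mul_div_assoc, div_lt_iff₀ (by positivity)]
    nlinarith
  linarith

end TimeScale

/-! ### The resolvent at infinity and Markov parameters -/

namespace TimeScale

open Matrix

section RatFunc

/-- The resolvent matrix `(zI - A)⁻¹` over the rational functions. -/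
noncomputable def resolventMatrix {n : ℕ} (A : Matrix (Fin n) (Fin n) ℝ) :
    Matrix (Fin n) (Fin n) (RatFunc ℝ) :=
  ((RatFunc.X : RatFunc ℝ) • (1 : Matrix (Fin n) (Fin n) (RatFunc ℝ)) - A.map RatFunc.C)⁻¹

theorem isUnit_X_smul_one_sub {n : ℕ} (A : Matrix (Fin n) (Fin n) ℝ) :
    IsUnit ((RatFunc.X : RatFunc ℝ) • (1 : Matrix (Fin n) (Fin n) (RatFunc ℝ))
      - A.map RatFunc.C) := by
  have e : (RatFunc.X : RatFunc ℝ) • (1 : Matrix (Fin n) (Fin n) (RatFunc ℝ)) - A.map RatFunc.C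
      = (algebraMap (Polynomial ℝ) (RatFunc ℝ)).mapMatrix A.charmatrix := by
    ext i j
    by_cases h : i = j
    · subst h
      simp [charmatrix_apply_eq]
    · simp [h]
  rw [isUnit_iff_isUnit_det, e, ← RingHom.map_det, isUnit_iff_ne_zero]
  exact RatFunc.algebraMap_ne_zero A.charpoly_monic.ne_zero

theorem sub_mul_resolventMatrix {n : ℕ} (A : Matrix (Fin n) (Fin n) ℝ) :
    ((RatFunc.X : RatFunc ℝ) • (1 : Matrix (Fin n) (Fin n) (RatFunc ℝ)) - A.map RatFunc.C) *
      resolventMatrix A = 1 :=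
  mul_nonsing_inv _ ((isUnit_iff_isUnit_det _).1 (isUnit_X_smul_one_sub A))

theorem resolventMatrix_mul_sub {n : ℕ} (A : Matrix (Fin n) (Fin n) ℝ) :
    resolventMatrix A *
      ((RatFunc.X : RatFunc ℝ) • (1 : Matrix (Fin n) (Fin n) (RatFunc ℝ)) - A.map RatFunc.C) = 1 :=
  nonsing_inv_mul _ ((isUnit_iff_isUnit_det _).1 (isUnit_X_smul_one_sub A))

theorem X_smul_resolventMatrix {n : ℕ} (A : Matrix (Fin n) (Fin n) ℝ) :
    (RatFunc.X : RatFunc ℝ) • resolventMatrix A = 1 + A.map RatFunc.C * resolventMatrix A := by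
  have h := sub_mul_resolventMatrix A
  rw [Matrix.sub_mul, smul_mul_assoc, Matrix.one_mul] at h
  rw [← h]; abel

open Classical in
/-- The valuation at infinity of rational functions. -/
noncomputable def valInfty : Valuation (RatFunc ℝ) (WithZero (Multiplicative ℤ)) :=
  RatFunc.inftyValuation ℝ

theorem valInfty_C {c : ℝ} (hc : c ≠ 0) : valInfty (RatFunc.C c) = 1 := by
  classical
  rw [← RatFunc.inftyValuation.C (F := ℝ) hc]
  unfold valInfty
  congr!

theorem one_lt_valInfty_X : 1 < valInfty RatFunc.X := by
  classical
  have : valInfty (RatFunc.X : RatFunc ℝ) = WithZero.exp 1 := by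
    rw [← RatFunc.inftyValuation.X ℝ]
    unfold valInfty
    congr!
  rw [this, ← WithZero.exp_zero, WithZero.exp_lt_exp]
  exact one_pos

theorem valInfty_C_le (c : ℝ) : valInfty (RatFunc.C c) ≤ 1 := by
  by_cases hc : c = 0
  · simp [hc]
  · exact (valInfty_C hc).le

/-- The resolvent is strictly proper. If its largest entry had valuation M ≥ 1, then zR = I + AR
would bound the valuation of z times that entry by M, although z has valuation > 1. -/
theorem valInfty_resolventMatrix_lt {n : ℕ} (A : Matrix (Fin n) (Fin n) ℝ) (i j : Fin n) :
    valInfty (resolventMatrix A i j) < 1 := by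
  obtain ⟨ij, -, hmax⟩ := Finset.exists_max_image (Finset.univ : Finset (Fin n × Fin n))
    (fun q => valInfty (resolventMatrix A q.1 q.2)) ⟨(i, j), Finset.mem_univ _⟩
  set M := valInfty (resolventMatrix A ij.1 ij.2) with hM
  refine (hmax (i, j) (Finset.mem_univ _)).trans_lt (not_le.1 fun h1 => ?_)
  have h := congr_fun (congr_fun (X_smul_resolventMatrix A) ij.1) ij.2
  rw [Matrix.smul_apply, smul_eq_mul, Matrix.add_apply, mul_apply] at h
  have h2 : valInfty (RatFunc.X * resolventMatrix A ij.1 ij.2) ≤ M := by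
    rw [h]
    refine Valuation.map_add_le _ ?_ (Valuation.map_sum_le _ fun k _ => ?_)
    · rw [one_apply]
      split_ifs
      · simpa using h1
      · simp
    · rw [map_mul, map_apply]
      exact (mul_le_mul' (valInfty_C_le _) (hmax (k, ij.2) (Finset.mem_univ _))).trans
        (one_mul _).le
  rw [map_mul, ← hM] at h2
  have h3 := mul_lt_mul_of_pos_right one_lt_valInfty_X (zero_lt_one.trans_le h1)
  rw [one_mul] at h3
  exact absurd h2 (not_le.2 h3)

theorem valInfty_map_mul_lt {a b c : Type*} [Fintype b] (M : Matrix a b ℝ)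
    {N : Matrix b c (RatFunc ℝ)} (hN : ∀ i j, valInfty (N i j) < 1) (i : a) (j : c) :
    valInfty ((M.map RatFunc.C * N) i j) < 1 := by
  rw [mul_apply]
  refine Valuation.map_sum_lt' _ one_pos fun k _ => ?_
  rw [map_mul, map_apply]
  exact (mul_le_mul_left (valInfty_C_le _) _).trans_lt ((one_mul _).trans_lt (hN k j))

theorem valInfty_mul_map_lt {a b c : Type*} [Fintype b] (M : Matrix b c ℝ)
    {N : Matrix a b (RatFunc ℝ)} (hN : ∀ i j, valInfty (N i j) < 1) (i : a) (j : c) :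
    valInfty ((N * M.map RatFunc.C) i j) < 1 := by
  rw [mul_apply]
  refine Valuation.map_sum_lt' _ one_pos fun k _ => ?_
  rw [map_mul, map_apply]
  exact (mul_le_mul_right (valInfty_C_le _) _).trans_lt ((mul_one _).trans_lt (hN i k))

end RatFunc

namespace LTISystem

variable {n m p : ℕ}

theorem X_smul_map_mul_resolventMatrix_mul (S : LTISystem n m p) (j : ℕ) :
    (RatFunc.X : RatFunc ℝ) • ((S.C * S.A ^ j).map RatFunc.C * resolventMatrix S.A *
      S.B.map RatFunc.C) = (S.C * S.A ^ j * S.B).map RatFunc.C +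
      (S.C * S.A ^ (j + 1)).map RatFunc.C * resolventMatrix S.A * S.B.map RatFunc.C := by
  rw [← Matrix.smul_mul, ← Matrix.mul_smul, X_smul_resolventMatrix, Matrix.mul_add, Matrix.add_mul,
    Matrix.mul_one, ← Matrix.mul_assoc, ← Matrix.map_mul, ← Matrix.map_mul, pow_succ,
    ← Matrix.mul_assoc S.C]

/-- Two systems with the same transfer function have the same Markov parameters. -/
theorem markov_eq {k : ℕ} {S : LTISystem n m p} {S' : LTISystem k m p}
    (h : S.transferFunction = S'.transferFunction) (j : ℕ) :
    S.C * S.A ^ j * S.B = S'.C * S'.A ^ j * S'.B := by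
  -- The difference of the two Markov parameters is a constant, of valuation 1 if nonzero, yet
  -- equals a difference of strictly proper functions.
  have step : ∀ j, (S.C * S.A ^ j).map RatFunc.C * resolventMatrix S.A * S.B.map RatFunc.C =
      (S'.C * S'.A ^ j).map RatFunc.C * resolventMatrix S'.A * S'.B.map RatFunc.C →
      S.C * S.A ^ j * S.B = S'.C * S'.A ^ j * S'.B := by
    intro j hj
    have e := X_smul_map_mul_resolventMatrix_mul S j
    rw [hj, X_smul_map_mul_resolventMatrix_mul S' j] at e
    ext a b
    have eab := congr_fun (congr_fun e a) b
    rw [Matrix.add_apply, Matrix.add_apply, map_apply, map_apply] at eab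
    by_contra hne
    have e2 : RatFunc.C ((S.C * S.A ^ j * S.B) a b - (S'.C * S'.A ^ j * S'.B) a b) =
        ((S'.C * S'.A ^ (j + 1)).map RatFunc.C * resolventMatrix S'.A * S'.B.map RatFunc.C) a b -
        ((S.C * S.A ^ (j + 1)).map RatFunc.C * resolventMatrix S.A * S.B.map RatFunc.C) a b := by
      rw [map_sub]; linear_combination -eab
    have e3 := valInfty_C (sub_ne_zero.2 hne)
    rw [e2] at e3
    refine absurd e3 (ne_of_lt (Valuation.map_sub_lt _ ?_ ?_)) <;>
    exact valInfty_mul_map_lt _ (valInfty_map_mul_lt _ (valInfty_resolventMatrix_lt _)) _ _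
  refine step j ?_
  induction j with
  | zero => simpa [transferFunction, resolventMatrix] using h
  | succ j ih =>
    have e := X_smul_map_mul_resolventMatrix_mul S j
    rw [ih, X_smul_map_mul_resolventMatrix_mul S' j, step j ih] at e
    exact (add_left_cancel e).symm

end LTISystem

end TimeScale

/-! ### Kalman's conditions, reduction and minimal dimension -/

namespace TimeScale

open Matrix

section LinearAlgebra

theorem submodule_eq_top_of_dotProduct {n : ℕ} {R : Submodule ℝ (Fin n → ℝ)}
    (h : ∀ w : Fin n → ℝ, (∀ x ∈ R, w ⬝ᵥ x = 0) → w = 0) : R = ⊤ := by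
  by_contra hne
  obtain ⟨f, hf, hker⟩ := Submodule.exists_le_ker_of_lt_top R (lt_top_iff_ne_top.2 hne)
  have e : ∀ x, f x = (fun i => f (Pi.single i 1)) ⬝ᵥ x := fun x => by
    rw [LinearMap.pi_apply_eq_sum_univ f x, dotProduct]
    exact Finset.sum_congr rfl fun i _ => by
      rw [smul_eq_mul, mul_comm]; congr 2; ext j; simp [Pi.single_apply, eq_comm]
  have hw := h (fun i => f (Pi.single i 1)) fun x hx => by
    rw [← e]; exact hker hx
  refine hf (LinearMap.ext fun x => ?_)
  rw [e, hw, zero_dotProduct, LinearMap.zero_apply]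

/-- Every subspace of `ℝⁿ` has a basis matrix with a left inverse. -/
theorem exists_basis_matrix {n : ℕ} (R : Submodule ℝ (Fin n → ℝ)) :
    ∃ (V : Matrix (Fin n) (Fin (Module.finrank ℝ R)) ℝ)
      (P : Matrix (Fin (Module.finrank ℝ R)) (Fin n) ℝ),
      P * V = 1 ∧ (∀ y, V *ᵥ y ∈ R) ∧ ∀ x ∈ R, V *ᵥ (P *ᵥ x) = x := by
  let e := (Module.finBasis ℝ R).equivFun
  let f : (Fin (Module.finrank ℝ R) → ℝ) →ₗ[ℝ] (Fin n → ℝ) := R.subtype ∘ₗ e.symm.toLinearMap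
  obtain ⟨g, hg⟩ := f.exists_leftInverse_of_injective
    (LinearMap.ker_eq_bot.2 (R.injective_subtype.comp e.symm.injective))
  have hgf : ∀ y, g (f y) = y := fun y => LinearMap.congr_fun hg y
  refine ⟨LinearMap.toMatrix' f, LinearMap.toMatrix' g, ?_, fun y => ?_, fun x hx => ?_⟩
  · rw [← LinearMap.toMatrix'_comp, hg, LinearMap.toMatrix'_id]
  · rw [LinearMap.toMatrix'_mulVec]
    exact (e.symm y).2
  · rw [LinearMap.toMatrix'_mulVec, LinearMap.toMatrix'_mulVec]
    have hx' : x = f (e ⟨x, hx⟩) := by simp [f]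
    rw [hx', hgf]

end LinearAlgebra

namespace LTISystem

variable {n m p : ℕ}

/-- Kalman's controllability condition: no nonzero row vector annihilates all `A ^ j * B`. -/
def KalmanControllable (S : LTISystem n m p) : Prop :=
  ∀ w : Fin n → ℝ, (∀ j : ℕ, w ᵥ* (S.A ^ j * S.B) = 0) → w = 0

/-- Kalman's observability condition: no nonzero vector is annihilated by all `C * A ^ j`. -/
def KalmanObservable (S : LTISystem n m p) : Prop :=
  ∀ v : Fin n → ℝ, (∀ j : ℕ, (S.C * S.A ^ j) *ᵥ v = 0) → v = 0

/-- The transposed (dual) system. -/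
def dual (S : LTISystem n m p) : LTISystem n p m := ⟨S.Aᵀ, S.Cᵀ, S.Bᵀ⟩

theorem kalmanControllable_dual (S : LTISystem n m p) :
    S.dual.KalmanControllable ↔ S.KalmanObservable := by
  unfold KalmanControllable KalmanObservable dual
  simp only [← transpose_pow, ← transpose_mul, vecMul_transpose]

theorem transferFunction_dual (S : LTISystem n m p) :
    S.dual.transferFunction = S.transferFunctionᵀ := by
  unfold transferFunction dual
  simp only [transpose_mul, transpose_nonsing_inv, transpose_sub, transpose_smul, transpose_one,
    transpose_map, Matrix.mul_assoc]

theorem Regressive.dual {T : Set ℝ} {S : LTISystem n m p} (h : S.Regressive T) :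
    S.dual.Regressive T := fun t ht => by
  have := h t ht
  rw [isUnit_iff_isUnit_det] at this ⊢
  rw [← det_transpose]
  simpa [LTISystem.dual] using this

/-- The largest `A`-invariant subspace on which the functional `w` vanishes. -/
def annihilated (S : LTISystem n m p) (w : Fin n → ℝ) : Submodule ℝ (Fin n → ℝ) where
  carrier := {x | ∀ j : ℕ, (w ᵥ* S.A ^ j) ⬝ᵥ x = 0}
  add_mem' hx hy j := by rw [dotProduct_add, hx j, hy j, add_zero]
  zero_mem' j := dotProduct_zero _
  smul_mem' c x hx j := by rw [dotProduct_smul, hx j, smul_zero]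

theorem mulVec_mem_annihilated {S : LTISystem n m p} {w x : Fin n → ℝ}
    (hx : x ∈ S.annihilated w) : S.A *ᵥ x ∈ S.annihilated w := fun j => by
  rw [dotProduct_mulVec, vecMul_vecMul, ← pow_succ]
  exact hx (j + 1)

theorem mulVec_B_mem_annihilated {S : LTISystem n m p} {w : Fin n → ℝ}
    (hw : ∀ j : ℕ, w ᵥ* (S.A ^ j * S.B) = 0) (y : Fin m → ℝ) :
    S.B *ᵥ y ∈ S.annihilated w := fun j => by
  rw [dotProduct_mulVec, vecMul_vecMul, hw, zero_dotProduct]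

theorem eq_zero_of_mem_annihilated {S : LTISystem n m p} {w : Fin n → ℝ}
    (h : w ∈ S.annihilated w) : w = 0 := by
  simpa using h 0

theorem mul_mul_eq_of_mulVec_mem {k l : ℕ} {R : Submodule ℝ (Fin n → ℝ)}
    {V : Matrix (Fin n) (Fin k) ℝ} {P : Matrix (Fin k) (Fin n) ℝ}
    (hVP : ∀ x ∈ R, V *ᵥ (P *ᵥ x) = x) {M : Matrix (Fin n) (Fin l) ℝ}
    (hM : ∀ y, M *ᵥ y ∈ R) : V * (P * M) = M := by
  refine ext_of_mulVec_single fun i => ?_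
  rw [← mulVec_mulVec, ← mulVec_mulVec]
  exact hVP _ (hM _)

/-- A regressive system that is not controllable can be reduced. -/
theorem exists_smaller_of_not_kalmanControllable {T : Set ℝ} {S : LTISystem n m p}
    (hS : S.Regressive T) (h : ¬ S.KalmanControllable) :
    ∃ k < n, ∃ S' : LTISystem k m p, S'.Regressive T ∧
      S'.transferFunction = S.transferFunction := by
  unfold KalmanControllable at h
  push Not at h
  obtain ⟨w, hw, hw0⟩ := h
  obtain ⟨V, P, hPV, hV, hVP⟩ := exists_basis_matrix (S.annihilated w)
  have hA : V * (P * (S.A * V)) = S.A * V := mul_mul_eq_of_mulVec_mem hVP fun y => by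
    rw [← mulVec_mulVec]; exact mulVec_mem_annihilated (hV y)
  have hB : V * (P * S.B) = S.B := mul_mul_eq_of_mulVec_mem hVP (mulVec_B_mem_annihilated hw)
  have hlt : Module.finrank ℝ (S.annihilated w) < n := by
    have := Submodule.finrank_lt (s := S.annihilated w) fun htop =>
      hw0 (eq_zero_of_mem_annihilated (htop ▸ Submodule.mem_top))
    simpa using this
  refine ⟨_, hlt, ⟨P * (S.A * V), P * S.B, S.C * V⟩, fun t ht => ?_, ?_⟩
  · rw [← mulVec_injective_iff_isUnit]
    have hinj := mulVec_injective_iff_isUnit.2 (hS t ht)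
    -- V intertwines the reduced and the full matrices, so injectivity of I + μA passes to the
    -- invariant subspace.
    have e : V * (1 + graininess T t • (P * (S.A * V))) =
        (1 + graininess T t • S.A) * V := by
      rw [Matrix.mul_add, Matrix.add_mul, Matrix.mul_smul, Matrix.smul_mul, hA, Matrix.mul_one,
        Matrix.one_mul]
    intro x y hxy
    have hVxy : V *ᵥ x = V *ᵥ y := hinj (by
      simp only [mulVec_mulVec, ← e]
      simp only [← mulVec_mulVec]
      exact congrArg _ hxy)
    have := congrArg (P *ᵥ ·) hVxy
    simpa [mulVec_mulVec, hPV] using this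
  · have hr : resolventMatrix S.A * V.map RatFunc.C =
        V.map RatFunc.C * resolventMatrix (P * (S.A * V)) := by
      have e : ((RatFunc.X : RatFunc ℝ) • (1 : Matrix (Fin n) (Fin n) (RatFunc ℝ))
          - S.A.map RatFunc.C) * V.map RatFunc.C = V.map RatFunc.C *
          ((RatFunc.X : RatFunc ℝ) • 1 - (P * (S.A * V)).map RatFunc.C) := by
        rw [Matrix.sub_mul, Matrix.mul_sub, ← Matrix.map_mul, ← Matrix.map_mul, hA]
        simp
      calc _ = resolventMatrix S.A * (V.map RatFunc.C *
            ((RatFunc.X : RatFunc ℝ) • 1 - (P * (S.A * V)).map RatFunc.C)) *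
            resolventMatrix (P * (S.A * V)) := by
            rw [Matrix.mul_assoc, Matrix.mul_assoc (V.map RatFunc.C), sub_mul_resolventMatrix,
              Matrix.mul_one]
        _ = _ := by
            rw [← e, ← Matrix.mul_assoc, resolventMatrix_mul_sub, Matrix.one_mul]
    change (S.C * V).map RatFunc.C * resolventMatrix (P * (S.A * V)) * (P * S.B).map RatFunc.C =
      S.C.map RatFunc.C * resolventMatrix S.A * S.B.map RatFunc.C
    conv_rhs => rw [← hB]
    rw [Matrix.map_mul (L := S.C), Matrix.map_mul (L := V), Matrix.mul_assoc (S.C.map _) (V.map _),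
      ← hr]
    simp only [Matrix.mul_assoc]

theorem IsMinimalRealization.kalmanControllable {T : Set ℝ} {S : LTISystem n m p}
    {G : Matrix (Fin p) (Fin m) (RatFunc ℝ)} (h : S.IsMinimalRealization T G) :
    S.KalmanControllable := by
  by_contra hK
  obtain ⟨k, hk, S', hr, ht⟩ := exists_smaller_of_not_kalmanControllable h.1.1 hK
  exact h.2 k hk S' ⟨hr, ht.trans h.1.2⟩

theorem IsMinimalRealization.kalmanObservable {T : Set ℝ} {S : LTISystem n m p}
    {G : Matrix (Fin p) (Fin m) (RatFunc ℝ)} (h : S.IsMinimalRealization T G) :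
    S.KalmanObservable := by
  by_contra hK
  rw [← kalmanControllable_dual] at hK
  obtain ⟨k, hk, S', hr, ht⟩ := exists_smaller_of_not_kalmanControllable h.1.1.dual hK
  refine h.2 k hk S'.dual ⟨hr.dual, ?_⟩
  rw [transferFunction_dual, ht, transferFunction_dual, transpose_transpose, h.1.2]

/-- The map sending a state `x` to the sequence `C * A ^ i * x`. -/
noncomputable def observationMap (S : LTISystem n m p) : (Fin n → ℝ) →ₗ[ℝ] (ℕ → Fin p → ℝ) :=
  LinearMap.pi fun i => (S.C * S.A ^ i).mulVecLin

theorem observationMap_apply (S : LTISystem n m p) (x : Fin n → ℝ) (i : ℕ) :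
    S.observationMap x i = (S.C * S.A ^ i) *ᵥ x := rfl

/-- A Kalman controllable and observable system has the least dimension among the systems with
the same transfer function. -/
theorem dim_le_of_kalman {k : ℕ} {S : LTISystem n m p} {S' : LTISystem k m p}
    (hc : S.KalmanControllable) (ho : S.KalmanObservable)
    (h : S.transferFunction = S'.transferFunction) : n ≤ k := by
  -- States whose observation sequence also arises from S' include every A^j B b, because C A^(i+j)
  -- B is common to both systems. By controllability these span everything.
  have htop : (LinearMap.range S'.observationMap).comap S.observationMap = ⊤ := by
    refine submodule_eq_top_of_dotProduct fun w hw => hc w fun j => ?_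
    refine dotProduct_eq_zero_iff.1 fun b => ?_
    rw [← dotProduct_mulVec]
    refine hw _ ⟨(S'.A ^ j * S'.B) *ᵥ b, ?_⟩
    funext i
    rw [observationMap_apply, observationMap_apply, mulVec_mulVec, mulVec_mulVec]
    congr 1
    have := markov_eq h (i + j)
    rw [pow_add, pow_add] at this
    simpa only [Matrix.mul_assoc] using this.symm
  have hinj : Function.Injective S.observationMap := by
    rw [injective_iff_map_eq_zero]
    exact fun v hv => ho v fun j => congr_fun hv j
  have hle : LinearMap.range S.observationMap ≤ LinearMap.range S'.observationMap := by
    rintro _ ⟨x, rfl⟩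
    have hx : x ∈ (LinearMap.range S'.observationMap).comap S.observationMap :=
      htop ▸ Submodule.mem_top
    exact hx
  have h1 := Submodule.finrank_mono hle
  have h2 := LinearMap.finrank_range_le S'.observationMap
  rw [LinearMap.finrank_range_of_inj hinj] at h1
  simpa using h1.trans h2

/-- Cayley–Hamilton: `A ^ j` is a combination of the powers `A ^ i` with `i < n`. -/
theorem exists_pow_eq_sum (A : Matrix (Fin n) (Fin n) ℝ) (j : ℕ) :
    ∃ a : ℕ → ℝ, A ^ j = ∑ i ∈ Finset.range n, a i • A ^ i := by
  -- For n = 0 the characteristic polynomial is 1, and the strict degree bound on the remainder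
  -- fails.
  rcases Nat.eq_zero_or_pos n with rfl | h
  · exact ⟨0, Subsingleton.elim _ _⟩
  refine ⟨(Polynomial.X ^ j %ₘ A.charpoly).coeff, ?_⟩
  rw [pow_eq_aeval_mod_charpoly, Polynomial.aeval_eq_sum_range' ?_]
  have hd : A.charpoly.natDegree = n := by simp
  conv_rhs => rw [← hd]
  refine Polynomial.natDegree_modByMonic_lt _ A.charpoly_monic fun h1 => ?_
  rw [h1, Polynomial.natDegree_one] at hd
  omega

end LTISystem

end TimeScale

/-! ### Solutions as generalized power series -/

namespace TimeScale

open Matrix Set Filter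

theorem rdContinuous_of_continuous {E : Type*} [TopologicalSpace E] {T : Set ℝ} {f : ℝ → E}
    (hf : Continuous f) : RdContinuous T f := fun t _ =>
  ⟨fun _ => hf.continuousWithinAt, f t, hf.continuousWithinAt⟩

theorem RdContinuous.add {E : Type*} [TopologicalSpace E] [Add E] [ContinuousAdd E] {T : Set ℝ}
    {f g : ℝ → E} (hf : RdContinuous T f) (hg : RdContinuous T g) :
    RdContinuous T fun t => f t + g t := fun t ht =>
  ⟨fun h => ((hf t ht).1 h).add ((hg t ht).1 h), by
    obtain ⟨a, ha⟩ := (hf t ht).2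
    obtain ⟨b, hb⟩ := (hg t ht).2
    exact ⟨a + b, ha.add hb⟩⟩

theorem RdContinuous.const_smul {E : Type*} [TopologicalSpace E] [SMul ℝ E]
    [ContinuousConstSMul ℝ E] {T : Set ℝ} {f : ℝ → E} (hf : RdContinuous T f) (c : ℝ) :
    RdContinuous T fun t => c • f t := fun t ht =>
  ⟨fun h => ((hf t ht).1 h).const_smul c, by
    obtain ⟨a, ha⟩ := (hf t ht).2
    exact ⟨c • a, ha.const_smul c⟩⟩

/-- Multiplication by a matrix as a continuous linear map. -/
noncomputable def mulVecCLM {k l : ℕ} (M : Matrix (Fin k) (Fin l) ℝ) :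
    (Fin l → ℝ) →L[ℝ] (Fin k → ℝ) := M.mulVecLin.toContinuousLinearMap

@[simp]
theorem mulVecCLM_apply {k l : ℕ} (M : Matrix (Fin k) (Fin l) ℝ) (v : Fin l → ℝ) :
    mulVecCLM M v = M *ᵥ v := rfl

/-- The added 1 makes the ratio at least 1, so that it is positive and exponents may be raised in
later bounds. -/
theorem norm_pow_mulVec_le {n : ℕ} (A : Matrix (Fin n) (Fin n) ℝ) (v : Fin n → ℝ) (j : ℕ) :
    ‖A ^ j *ᵥ v‖ ≤ ‖v‖ * (‖mulVecCLM A‖ + 1) ^ j := by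
  induction j with
  | zero => simp
  | succ j ih =>
    rw [pow_succ' A, ← mulVec_mulVec, ← mulVecCLM_apply]
    calc _ ≤ ‖mulVecCLM A‖ * (‖v‖ * (‖mulVecCLM A‖ + 1) ^ j) :=
          (mulVecCLM A).le_opNorm_of_le ih
      _ ≤ (‖mulVecCLM A‖ + 1) * (‖v‖ * (‖mulVecCLM A‖ + 1) ^ j) := by gcongr; linarith
      _ = _ := by rw [pow_succ]; ring

theorem isLeast_inter_Ici {T : Set ℝ} {t₀ : ℝ} (h : t₀ ∈ T) : IsLeast (T ∩ Ici t₀) t₀ :=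
  ⟨⟨h, self_mem_Ici⟩, fun _ h => h.2⟩

namespace LTISystem

variable {n m p : ℕ} {T : Set ℝ} {S : LTISystem n m p} {t₀ : ℝ}

section Solutions

theorem IsSolution.add {u u' : ℝ → Fin m → ℝ} {x x' : ℝ → Fin n → ℝ}
    (h : S.IsSolution T t₀ u x) (h' : S.IsSolution T t₀ u' x') :
    S.IsSolution T t₀ (fun t => u t + u' t) (fun t => x t + x' t) := fun t ht htt => by
  have := (h t ht htt).add (h' t ht htt)
  rwa [add_add_add_comm, ← mulVec_add, ← mulVec_add] at this

theorem IsSolution.const_smul {u : ℝ → Fin m → ℝ} {x : ℝ → Fin n → ℝ}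
    (h : S.IsSolution T t₀ u x) (c : ℝ) :
    S.IsSolution T t₀ (fun t => c • u t) (fun t => c • x t) := fun t ht htt => by
  have := (h t ht htt).const_smul c
  rwa [smul_add, ← mulVec_smul, ← mulVec_smul] at this

theorem isSolution_zero : S.IsSolution T t₀ (fun _ => 0) (fun _ => 0) := fun t _ _ => by
  simpa using hasDeltaDerivAt_const (T := T ∩ Ici t₀) (t := t) (0 : Fin n → ℝ)

/-- Solutions as generalized power series. -/
theorem isSolution_tsum (hc : IsClosed T) (hu : ¬ BddAbove T) (ht₀ : t₀ ∈ T)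
    {c d : ℕ → Fin n → ℝ} {K r : ℝ} (hcK : ∀ k, ‖c k‖ ≤ K * r ^ k)
    (hrec : ∀ k, c (k + 1) = S.A *ᵥ c k + d k) {u : ℝ → Fin m → ℝ}
    (hd : ∀ t, ∑' k, genMonomial (T ∩ Ici t₀) t₀ k t • d k = S.B *ᵥ u t) :
    S.IsSolution T t₀ u fun t => ∑' k, genMonomial (T ∩ Ici t₀) t₀ k t • c k := by
  intro t ht htt
  have hc' := hc.inter (isClosed_Ici (a := t₀))
  have hl := isLeast_inter_Ici ht₀
  have h := hasDeltaDerivAt_tsum_genMonomial_smul hc' (not_bddAbove_inter_Ici hu t₀) hl hcK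
    ⟨ht, htt⟩
  convert h using 1
  have hcK' : ∀ k, ‖c (k + 1)‖ ≤ K * r * r ^ k := fun k => by
    have := hcK (k + 1)
    rwa [pow_succ', ← mul_assoc] at this
  have hs := summable_genMonomial_smul hc' hl hcK t
  have hs1 := summable_genMonomial_smul (c := fun k => c (k + 1)) hc' hl hcK' t
  have hsA : Summable fun k => mulVecCLM S.A (genMonomial (T ∩ Ici t₀) t₀ k t • c k) :=
    hs.map (mulVecCLM S.A) (mulVecCLM S.A).continuous
  have e : ∀ k, genMonomial (T ∩ Ici t₀) t₀ k t • d k =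
      genMonomial (T ∩ Ici t₀) t₀ k t • c (k + 1) -
      mulVecCLM S.A (genMonomial (T ∩ Ici t₀) t₀ k t • c k) := fun k => by
    rw [hrec, mulVecCLM_apply, mulVec_smul, smul_add, add_sub_cancel_left]
  rw [← hd, tsum_congr e, hs1.tsum_sub hsA, ← (mulVecCLM S.A).map_tsum hs, mulVecCLM_apply]
  abel

/-- The solution of the homogeneous equation. -/
theorem isSolution_tsum_pow (hc : IsClosed T) (hu : ¬ BddAbove T) (ht₀ : t₀ ∈ T)
    (v : Fin n → ℝ) : S.IsSolution T t₀ (fun _ => 0)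
      fun t => ∑' k, genMonomial (T ∩ Ici t₀) t₀ k t • (S.A ^ k *ᵥ v) :=
  isSolution_tsum (d := fun _ => 0) hc hu ht₀ (norm_pow_mulVec_le S.A v)
    (fun k => by rw [pow_succ', ← mulVec_mulVec, add_zero]) (fun t => by simp)

end Solutions

/-! ### Observability -/

section Observability

/-- A system observable on some interval is observable in the sense of Kalman. -/
theorem ObservableOn.kalmanObservable (hc : IsClosed T) (hu : ¬ BddAbove T) (ht₀ : t₀ ∈ T)
    {t_f : ℝ} (h : S.ObservableOn T t₀ t_f) : S.KalmanObservable := by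
  intro v hv
  have := h _ _ (isSolution_tsum_pow hc hu ht₀ v) isSolution_zero fun t ht htt _ => by
    have hs := summable_genMonomial_smul (hc.inter (isClosed_Ici (a := t₀)))
      (isLeast_inter_Ici ht₀) (norm_pow_mulVec_le S.A v) t
    rw [mulVec_zero, ← mulVecCLM_apply, (mulVecCLM S.C).map_tsum hs]
    refine (tsum_congr fun k => ?_).trans tsum_zero
    rw [mulVecCLM_apply, mulVec_smul, mulVec_mulVec, hv, smul_zero]
  rw [tsum_genMonomial_smul_self] at this
  simpa using this

/-- If the output of the homogeneous system vanishes on a sufficiently long interval, then so do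
its first `k` delta derivatives on a prescribed one. -/
theorem exists_forall_output_deriv_eq_zero (hc : IsClosed T) (hu : ¬ BddAbove T)
    (S : LTISystem n m p) (t₀ : ℝ) (k : ℕ) {r : ℝ} (hr : r ∈ T) :
    ∃ τ ∈ T, r ≤ τ ∧ ∀ x : ℝ → Fin n → ℝ, S.IsSolution T t₀ (fun _ => 0) x →
      (∀ t ∈ T, t₀ ≤ t → t < τ → S.C *ᵥ x t = 0) →
      ∀ j ≤ k, ∀ t ∈ T, t₀ ≤ t → t < r → (S.C * S.A ^ j) *ᵥ x t = 0 := by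
  induction k generalizing r with
  | zero =>
    refine ⟨r, hr, le_rfl, fun x _ h j hj t ht htt htr => ?_⟩
    rw [Nat.le_zero.1 hj, pow_zero, Matrix.mul_one]
    exact h t ht htt htr
  | succ k ih =>
    -- The next derivative at t < r involves the value at σ(t) ≤ r, so the earlier derivatives must
    -- vanish slightly beyond r.
    obtain ⟨r', hr', hrr'⟩ := not_bddAbove_iff.1 hu r
    obtain ⟨τ, hτ, hle, H⟩ := ih hr'
    refine ⟨τ, hτ, hrr'.le.trans hle, fun x hx h j hj t ht htt htr => ?_⟩
    rcases Nat.le_succ_iff.1 hj with hj | rfl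
    · exact H x hx h j hj t ht htt (htr.trans hrr')
    have hd := (hx t ht htt).clm_comp (mulVecCLM (S.C * S.A ^ k))
    have hσ : sigma (T ∩ Ici t₀) t < r' := by
      rw [sigma_inter_Ici htt]
      exact (sigma_le hr htr).trans_lt hrr'
    have hu' := not_bddAbove_inter_Ici hu t₀
    have h0 := hd.eq_zero hu' ⟨ht, htt⟩ (htr.trans hrr') hσ
      (fun s hs _ hsr => H x hx h k le_rfl s hs.1 hs.2 hsr)
      (sigma_mem (hc.inter isClosed_Ici) hu' t)
    rw [pow_succ, ← Matrix.mul_assoc, ← mulVec_mulVec]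
    simpa using h0

theorem KalmanObservable.exists_observableOn (hc : IsClosed T) (hu : ¬ BddAbove T)
    (ht₀ : t₀ ∈ T) (hK : S.KalmanObservable) :
    ∃ τ ∈ T, t₀ < τ ∧ ∀ t_f, τ ≤ t_f → S.ObservableOn T t₀ t_f := by
  obtain ⟨r, hr, htr⟩ := not_bddAbove_iff.1 hu t₀
  obtain ⟨τ, hτ, hle, H⟩ := exists_forall_output_deriv_eq_zero hc hu S t₀ n hr
  refine ⟨τ, hτ, htr.trans_le hle, fun t_f htf x x' hx hx' h => ?_⟩
  have hsol : S.IsSolution T t₀ (fun _ => 0) fun t => x t + (-1 : ℝ) • x' t := by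
    simpa using hx.add (hx'.const_smul (-1))
  have h0 := H _ hsol fun t ht htt htτ => by
    rw [mulVec_add, mulVec_smul, h t ht htt (htτ.trans_le htf)]
    simp
  have := hK (x t₀ + (-1 : ℝ) • x' t₀) fun j => by
    obtain ⟨a, ha⟩ := exists_pow_eq_sum S.A j
    rw [ha, Matrix.mul_sum, sum_mulVec]
    refine Finset.sum_eq_zero fun i hi => ?_
    rw [Matrix.mul_smul, smul_mulVec, h0 i (Finset.mem_range.1 hi).le t₀ ht₀ le_rfl htr, smul_zero]
  rw [neg_one_smul, ← sub_eq_add_neg, sub_eq_zero] at this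
  exact this

end Observability

/-! ### Controllability -/

section Controllability

/-- A system controllable on some interval is controllable in the sense of Kalman. -/
theorem ControllableOn.kalmanControllable (hc : IsClosed T) (hu : ¬ BddAbove T) (ht₀ : t₀ ∈ T)
    {t_f : ℝ} (htf : t_f ∈ T) (hle : t₀ ≤ t_f) (h : S.ControllableOn T t₀ t_f) :
    S.KalmanControllable := by
  intro w hw
  obtain ⟨u, -, x, hx, hx0, hxf⟩ := h 0 w
  obtain ⟨V, P, -, hV, hVP⟩ := exists_basis_matrix (S.annihilated w)
  -- VP projects onto the invariant subspace, so z = (1 - VP)x obeys z^Δ = (1 - VP)A z with the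
  -- input gone, and z = 0 by Gronwall.
  have hA : ∀ y, (1 - V * P) *ᵥ (S.A *ᵥ (V *ᵥ (P *ᵥ y))) = 0 := fun y => by
    rw [sub_mulVec, one_mulVec, ← mulVec_mulVec, hVP _ (mulVec_mem_annihilated (hV _)), sub_self]
  have hB : ∀ y, (1 - V * P) *ᵥ (S.B *ᵥ y) = 0 := fun y => by
    rw [sub_mulVec, one_mulVec, ← mulVec_mulVec, hVP _ (mulVec_B_mem_annihilated hw y), sub_self]
  have hz := eq_zero_of_norm_deltaDeriv_le (hc.inter (isClosed_Ici (a := t₀)))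
    (not_bddAbove_inter_Ici hu t₀) (isLeast_inter_Ici ht₀)
    (fun t ht => (hx t ht.1 ht.2).clm_comp (mulVecCLM (1 - V * P)))
    (L := ‖mulVecCLM ((1 - V * P) * S.A)‖ + 1) (by positivity) (fun t ht => ?_)
    (by rw [hx0, map_zero]) t_f ⟨htf, hle⟩
  -- The final state w lies in its own annihilated subspace, so w · w = 0.
  · rw [hxf, mulVecCLM_apply, sub_mulVec, one_mulVec, sub_eq_zero, ← mulVec_mulVec] at hz
    have hmem := hV (P *ᵥ w)
    rw [← hz] at hmem
    exact eq_zero_of_mem_annihilated hmem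
  · have e : mulVecCLM (1 - V * P) (S.A *ᵥ x t + S.B *ᵥ u t) =
        mulVecCLM ((1 - V * P) * S.A) (mulVecCLM (1 - V * P) (x t)) := by
      simp only [mulVecCLM_apply]
      rw [mulVec_add, hB, add_zero, ← mulVec_mulVec, sub_mulVec 1 (V * P) (x t), one_mulVec,
        mulVec_sub, mulVec_sub, ← mulVec_mulVec (x t), hA, sub_zero]
    rw [e]
    refine ((mulVecCLM ((1 - V * P) * S.A)).le_opNorm _).trans ?_
    gcongr
    linarith

/-- The states that can be reached from `0` on `[t₀, t_f]`. -/
def reachable (T : Set ℝ) (S : LTISystem n m p) (t₀ t_f : ℝ) : Submodule ℝ (Fin n → ℝ) where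
  carrier := {y | ∃ u, RdContinuous T u ∧ ∃ x, S.IsSolution T t₀ u x ∧ x t₀ = 0 ∧ x t_f = y}
  add_mem' := by
    rintro _ _ ⟨u, hu, x, hx, hx0, rfl⟩ ⟨u', hu', x', hx', hx0', rfl⟩
    exact ⟨_, hu.add hu', _, hx.add hx', by simp [hx0, hx0'], rfl⟩
  zero_mem' := ⟨fun _ => 0, rdContinuous_of_continuous continuous_const, fun _ => 0,
    isSolution_zero, rfl, rfl⟩
  smul_mem' := by
    rintro c _ ⟨u, hu, x, hx, hx0, rfl⟩
    exact ⟨_, hu.const_smul c, _, hx.const_smul c, by simp [hx0], rfl⟩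

/-- By superposition, it is enough to add to the free motion from x₀ a response from 0 that corrects
the final state. -/
theorem controllableOn_of_reachable_eq_top (hc : IsClosed T) (hu : ¬ BddAbove T) (ht₀ : t₀ ∈ T)
    {t_f : ℝ} (h : S.reachable T t₀ t_f = ⊤) : S.ControllableOn T t₀ t_f := by
  intro x₀ x_f
  set X : ℝ → Fin n → ℝ := fun t => ∑' k, genMonomial (T ∩ Ici t₀) t₀ k t • (S.A ^ k *ᵥ x₀)
  have hy : x_f - X t_f ∈ S.reachable T t₀ t_f := h ▸ Submodule.mem_top
  obtain ⟨u, hud, x, hx, hx0, hxf⟩ := hy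
  refine ⟨u, hud, fun t => X t + x t, ?_, ?_, ?_⟩
  · simpa using (isSolution_tsum_pow hc hu ht₀ x₀).add hx
  · change X t₀ + x t₀ = x₀
    rw [hx0, add_zero]
    exact (tsum_genMonomial_smul_self _).trans (by simp)
  · change X t_f + x t_f = x_f
    rw [hxf, add_sub_cancel]

/-- The coefficients of the power series of the response to the input `h_k(t, t₀) v`. -/
noncomputable def responseCoeff (S : LTISystem n m p) (v : Fin m → ℝ) (k j : ℕ) : Fin n → ℝ :=
  if j ≤ k then 0 else S.A ^ (j - (k + 1)) *ᵥ (S.B *ᵥ v)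

theorem responseCoeff_of_le (v : Fin m → ℝ) {k j : ℕ} (h : j ≤ k) : S.responseCoeff v k j = 0 :=
  if_pos h

theorem responseCoeff_add (v : Fin m → ℝ) (k j : ℕ) :
    S.responseCoeff v k (j + (k + 1)) = (S.A ^ j * S.B) *ᵥ v := by
  rw [responseCoeff, if_neg (by omega), Nat.add_sub_cancel, mulVec_mulVec]

theorem norm_responseCoeff_le (v : Fin m → ℝ) (k j : ℕ) :
    ‖S.responseCoeff v k j‖ ≤ ‖S.B *ᵥ v‖ * (‖mulVecCLM S.A‖ + 1) ^ j := by
  unfold responseCoeff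
  split_ifs with h
  · rw [norm_zero]
    positivity
  · refine (norm_pow_mulVec_le _ _ _).trans ?_
    gcongr
    · linarith [norm_nonneg (mulVecCLM S.A)]
    · omega

/-- This is the coefficient recursion c_{j+1} = A c_j + d_j of the equation, where the input series
d has B v as its only nonzero candidate, at j = k. -/
theorem responseCoeff_succ (v : Fin m → ℝ) (k j : ℕ) : S.responseCoeff v k (j + 1) =
    S.A *ᵥ S.responseCoeff v k j + if j = k then S.B *ᵥ v else 0 := by
  rcases lt_trichotomy j k with h | h | h
  · simp [responseCoeff, h.le, h.ne, Nat.succ_le_of_lt h]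
  · simp [responseCoeff, h]
  · have e : j + 1 - (k + 1) = (j - (k + 1)) + 1 := by omega
    simp only [responseCoeff, if_neg (show ¬ j + 1 ≤ k by omega), if_neg (not_le.2 h),
      if_neg h.ne', add_zero, e, pow_succ', ← mulVec_mulVec]

/-- The state at `t_f` under the input `h_k(t, t₀) v`. -/
theorem exists_hasSum_mem_reachable (hc : IsClosed T) (hu : ¬ BddAbove T) (ht₀ : t₀ ∈ T) (t_f : ℝ)
    (v : Fin m → ℝ) (k : ℕ) :
    ∃ y ∈ S.reachable T t₀ t_f, HasSum
      (fun j => genMonomial (T ∩ Ici t₀) t₀ (k + 1 + j) t_f • ((S.A ^ j * S.B) *ᵥ v)) y := by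
  have hc' := hc.inter (isClosed_Ici (a := t₀))
  have hl := isLeast_inter_Ici ht₀
  have hsol : S.IsSolution T t₀ (fun t => genMonomial (T ∩ Ici t₀) t₀ k t • v)
      fun t => ∑' j, genMonomial (T ∩ Ici t₀) t₀ j t • S.responseCoeff v k j :=
    isSolution_tsum hc hu ht₀ (norm_responseCoeff_le v k) (responseCoeff_succ v k) fun t => by
      rw [tsum_eq_single k fun j hj => by simp [hj], if_pos rfl, mulVec_smul]
  refine ⟨_, ⟨_, rdContinuous_of_continuous
    ((continuous_genMonomial hc' hl k).smul continuous_const), _, hsol, ?_, rfl⟩, ?_⟩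
  · rw [tsum_genMonomial_smul_self, responseCoeff_of_le v k.zero_le]
  · have hs := (summable_genMonomial_smul hc' hl
      (norm_responseCoeff_le (S := S) v k) t_f).hasSum
    rw [← hasSum_nat_add_iff' (k + 1), Finset.sum_eq_zero, sub_zero] at hs
    · simp only [responseCoeff_add] at hs
      simpa only [add_comm (k + 1)] using hs
    · intro j hj
      rw [responseCoeff_of_le v (Nat.lt_succ_iff.1 (Finset.mem_range.1 hj)), smul_zero]

theorem KalmanControllable.controllableOn (hc : IsClosed T) (hu : ¬ BddAbove T) (ht₀ : t₀ ∈ T)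
    {t_f : ℝ} (hle : t₀ ≤ t_f) (hpos : 0 < genMonomial (T ∩ Ici t₀) t₀ n t_f)
    (hK : S.KalmanControllable) : S.ControllableOn T t₀ t_f := by
  have hc' := hc.inter (isClosed_Ici (a := t₀))
  have hl := isLeast_inter_Ici ht₀
  refine controllableOn_of_reachable_eq_top hc hu ht₀
    (submodule_eq_top_of_dotProduct fun w hw => hK w fun j => ?_)
  refine dotProduct_eq_zero_iff.1 fun v => ?_
  let φ : (Fin n → ℝ) →L[ℝ] ℝ := (dotProductBilin ℝ ℝ w).toContinuousLinearMap
  have hφ : ∀ x, φ x = w ⬝ᵥ x := fun _ => rfl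
  -- Orthogonality of w to the responses for all k is exactly the family of shifted sums, with g i =
  -- w · A^i B v.
  have hzero : ∀ i < n, φ ((S.A ^ i * S.B) *ᵥ v) = 0 := by
    refine eq_zero_of_forall_tsum_shift_eq_zero (R := |t_f - t₀|) (r := ‖mulVecCLM S.A‖ + 1)
      (K := ‖φ‖ * ‖S.B *ᵥ v‖) (h := fun i => genMonomial (T ∩ Ici t₀) t₀ i t_f)
      (fun i => genMonomial_nonneg hc' hl i hle)
      (fun i => (le_abs_self _).trans (abs_genMonomial_le hc' hl i t_f)) (by positivity)
      (fun i => ?_) (fun k => ?_) hpos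
    · rw [← mulVec_mulVec, mul_assoc]
      exact φ.le_opNorm_of_le (norm_pow_mulVec_le _ _ _)
    · obtain ⟨y, hy, hs⟩ := exists_hasSum_mem_reachable hc hu ht₀ t_f v k
      have hs' := (hs.mapL φ).tsum_eq
      rw [hφ y, hw y hy] at hs'
      rw [← hs']
      exact tsum_congr fun j => by rw [map_smul, smul_eq_mul]
  obtain ⟨a, ha⟩ := exists_pow_eq_sum S.A j
  rw [← dotProduct_mulVec, ← hφ, ha, Matrix.sum_mul, sum_mulVec, map_sum]
  refine Finset.sum_eq_zero fun i hi => ?_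
  rw [Matrix.smul_mul, smul_mulVec, map_smul, hzero i (Finset.mem_range.1 hi), smul_zero]

end Controllability

theorem exists_controllableOn_and_observableOn (hc : IsClosed T) (hu : ¬ BddAbove T)
    (ht₀ : t₀ ∈ T) (hKc : S.KalmanControllable) (hKo : S.KalmanObservable) :
    ∃ t_f ∈ T, t₀ < t_f ∧ S.ControllableOn T t₀ t_f ∧ S.ObservableOn T t₀ t_f := by
  obtain ⟨τ, hτ, hlt, hobs⟩ := hKo.exists_observableOn hc hu ht₀
  obtain ⟨t₁, h₁, hpos⟩ := exists_genMonomial_pos (hc.inter (isClosed_Ici (a := t₀)))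
    (not_bddAbove_inter_Ici hu t₀) (isLeast_inter_Ici ht₀) n
  -- Both properties persist for all later final times, so the larger threshold serves for both.
  have hm : max τ t₁ ∈ T := by
    rcases max_choice τ t₁ with h | h <;> rw [h]
    exacts [hτ, h₁.1]
  have hlt' := hlt.trans_le (le_max_left τ t₁)
  exact ⟨max τ t₁, hm, hlt', hKc.controllableOn hc hu ht₀ hlt'.le (hpos _ (le_max_right _ _)),
    hobs _ (le_max_left _ _)⟩

end LTISystem

end TimeScale

theorem theorem4p6 (T : Set ℝ) (hT : TimeScale.IsTimeScale T) (hunb : ¬ BddAbove T)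
    (hgr : TimeScale.HasBoundedGraininess T) {n m p : ℕ}
    (G : Matrix (Fin p) (Fin m) (RatFunc ℝ)) (S : TimeScale.LTISystem n m p)
    (hS : S.IsRealization T G) :
    (S.IsMinimalRealization T G ↔ S.Controllable T ∧ S.Observable T) ∧
    (S.IsMinimalRealization T G → ∀ t₀ ∈ T, ∃ t_f ∈ T, t₀ < t_f ∧
      S.ControllableOn T t₀ t_f ∧ S.ObservableOn T t₀ t_f) := by
  have main : S.IsMinimalRealization T G → ∀ t₀ ∈ T, ∃ t_f ∈ T, t₀ < t_f ∧
      S.ControllableOn T t₀ t_f ∧ S.ObservableOn T t₀ t_f := fun hmin t₀ ht₀ =>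
    TimeScale.LTISystem.exists_controllableOn_and_observableOn hT.2 hunb ht₀
      hmin.kalmanControllable hmin.kalmanObservable
  refine ⟨⟨fun hmin => ?_, ?_⟩, main⟩
  · obtain ⟨t₀, ht₀⟩ := hT.1
    obtain ⟨t_f, htf, hlt, hcon, hobs⟩ := main hmin t₀ ht₀
    exact ⟨⟨t₀, ht₀, t_f, htf, hlt, hcon⟩, ⟨t₀, ht₀, t_f, htf, hlt, hobs⟩⟩
  · rintro ⟨⟨t₀, ht₀, t_f, htf, hlt, hcon⟩, ⟨s₀, hs₀, s_f, hsf, hlt', hobs⟩⟩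
    refine ⟨hS, fun k hk S' hS' => absurd hk (not_lt.2 ?_)⟩
    exact TimeScale.LTISystem.dim_le_of_kalman (hcon.kalmanControllable hT.2 hunb ht₀ htf hlt.le)
      (hobs.kalmanObservable hT.2 hunb hs₀) (hS.2.trans hS'.2.symm)
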